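/- Let $X$ be a proper geodesic metric space that is $\delta$-hyperbolic for some $\delta>0$ (each point on an edge of any geodesic triangle is within distance $\delta$ of the union of the other two edges). Put $(x|y)_w=\tfrac12\big(d(x,w)+d(y,w)-d(x,y)\big)$. The Gromov boundary $\partial X$ is the set of sequences $(x_i)$ in $X$ with $(x_i|x_j)_w\to\infty$ as $i,j\to\infty$, modulo the equivalence $(x_i)\sim(y_i)$ iff $(x_i|y_i)_w\to\infty$; this does not depend on $w$. Assume that $X$ has a pole: there are $L\ge 0$ and $o\in X\cup\partial X$ such that each point of $X$ is within distance $L$ of some geodesic connecting $o$ to some point of $\partial X$ (a geodesic ray if $o\in X$, a bi-infinite geodesic if $o\in\partial X$). For $w\in X$ and $0<\varepsilon<\min\{1,\tfrac1{5\delta}\}$ let $d_{w,\varepsilon}$ be the visual metric on $\partial X$: $$d_{w,\varepsilon}(\xi,\zeta)=\inf\Big\{\sum_{i=1}^n e^{-\varepsilon(\xi_{i-1}|\xi_i)_w} : n\ge1,\ \xi=\xi_0,\xi_1,\dots,\xi_n=\zeta\in\partial X\Big\},\qquad (\xi|\zeta)_w=\inf\liminf_{i\to\infty}(x_i|y_i)_w,$$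 where $e^{-\infty}=0$ and the last infimum is over all sequences $(x_i)\in\xi$, $(y_i)\in\zeta$. **Theorem.** For every $w\in X$ and every $\varepsilon$ with $0<\varepsilon<\min\{1,\tfrac1{5\delta}\}$ the following are equivalent: 1. $X$ is boundary rigid: every quasi-isometry $f:X\to X$ whose induced map on $\partial X$ is the identity satisfies $\sup_{x\in X}d(x,f(x))<\infty$. 2. $(\partial X,d_{w,\varepsilon})$ is uniformly perfect: there are $S\ge1$ and $r_0>0$ such that for every $\xi\in\partial X$ and every $0<r\le r_0$ there is $\zeta\in\partial X$ with $r/S<d_{w,\varepsilon}(\xi,\zeta)\le r$. 3. $X$ is geodesically rich: there are constants $r_0,r_1,r_2,r_3,r_4$ such that (i) for all $p,q\in X$ with $d(p,q)\ge r_0$ there is a bi-infinite geodesic $\gamma$ with $d(p,\gamma)<r_1$ and $|d(q,\gamma)-d(p,q)|<r_2$; and (ii) for every bi-infinite geodesic $\gamma$ and every $p\in X$ there is a bi-infinite geodesic $\gamma'$ with $d(p,\gamma')<r_3$ and $|d(p,\gamma)-d(\gamma',\gamma)|<r_4$, where $d(\gamma',\gamma)$ is the infimum of the distances between points of $\gamma'$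 and points of $\gamma$. -/

import Mathlib

open Filter Topology

noncomputable section

namespace Hyp

/-! ### Geodesics -/

/-- `S` is (the image of) a geodesic segment from `x` to `y`, parametrized by arc length. -/
def IsSegment {X : Type*} [MetricSpace X] (S : Set X) (x y : X) : Prop :=
  ∃ γ : ℝ → X, γ 0 = x ∧ γ (dist x y) = y ∧
    (∀ s ∈ Set.Icc 0 (dist x y), ∀ t ∈ Set.Icc 0 (dist x y), dist (γ s) (γ t) = |s - t|) ∧
    S = γ '' Set.Icc 0 (dist x y)

/-- Every two points are joined by a geodesic segment. -/
def IsGeodesicSpace (X : Type*) [MetricSpace X] : Prop :=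
  ∀ x y : X, ∃ S : Set X, IsSegment S x y

/-- `γ`, restricted to `[0, ∞)`, is a geodesic ray starting at `o`. -/
def IsRay {X : Type*} [MetricSpace X] (γ : ℝ → X) (o : X) : Prop :=
  γ 0 = o ∧ ∀ s ∈ Set.Ici (0 : ℝ), ∀ t ∈ Set.Ici (0 : ℝ), dist (γ s) (γ t) = |s - t|

/-- `γ` is a bi-infinite geodesic. -/
def IsLine {X : Type*} [MetricSpace X] (γ : ℝ → X) : Prop :=
  Isometry γ

/-! ### Hyperbolicity and the Gromov boundary -/

/-- `δ`-hyperbolicity of a geodesic space: in every geodesic triangle, each point of an edge is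
within distance `δ` of the union of the other two edges. (All three edges are covered, since
`x, y, z` are arbitrary.) -/
def IsHyperbolic (δ : ℝ) (X : Type*) [MetricSpace X] : Prop :=
  ∀ (x y z : X) (A B C : Set X), IsSegment A x y → IsSegment B y z → IsSegment C x z →
    ∀ p ∈ A, ∃ q ∈ B ∪ C, dist p q ≤ δ

/-- The Gromov product `(x|y)_w`. -/
def gromovProd {X : Type*} [MetricSpace X] (w x y : X) : ℝ :=
  (dist x w + dist y w - dist x y) / 2

/-- `(u i | u j)_w → ∞` as `i, j → ∞`. Changing the base point `w` changes Gromov products by a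
bounded amount only, so it does not matter which `w` is used; we ask for all of them. -/
def IsGromovSeq {X : Type*} [MetricSpace X] (u : ℕ → X) : Prop :=
  ∀ w : X, Tendsto (fun p : ℕ × ℕ => gromovProd w (u p.1) (u p.2)) atTop atTop

/-- The type of Gromov sequences. -/
def GromovSeq (X : Type*) [MetricSpace X] : Type _ :=
  {u : ℕ → X // IsGromovSeq u}

/-- `(u i | v i)_w → ∞`. -/
def GromovSeq.Equivalent {X : Type*} [MetricSpace X] (u v : GromovSeq X) : Prop :=
  ∀ w : X, Tendsto (fun i : ℕ => gromovProd w (u.1 i) (v.1 i)) atTop atTop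

/-- The Gromov boundary `∂X`: the quotient of the set of Gromov sequences by equivalence.
(In a hyperbolic space, the only case of interest, the relation is an equivalence relation.) -/
def Boundary (X : Type*) [MetricSpace X] : Type _ :=
  Quot (GromovSeq.Equivalent (X := X))

/-- `u ∈ ξ`: the sequence `u` is a Gromov sequence and its class is `ξ`. -/
def Represents {X : Type*} [MetricSpace X] (u : ℕ → X) (ξ : Boundary X) : Prop :=
  ∃ h : IsGromovSeq u, (Quot.mk _ ⟨u, h⟩ : Boundary X) = ξ

/-! ### Poles -/

/-- `S` is a geodesic connecting a point `o` of the Gromov closure `X ∪ ∂X` to `v ∈ ∂X`: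
a ray from `o` to `v` if `o ∈ X`, a bi-infinite geodesic from `o` to `v` if `o ∈ ∂X`. -/
def IsGeodesicTo {X : Type*} [MetricSpace X] (S : Set X) (v : Boundary X) :
    X ⊕ Boundary X → Prop
  | Sum.inl o => ∃ γ : ℝ → X, IsRay γ o ∧ Represents (fun n : ℕ => γ n) v ∧
      S = γ '' Set.Ici 0
  | Sum.inr o => ∃ γ : ℝ → X, IsLine γ ∧ Represents (fun n : ℕ => γ (-(n : ℝ))) o ∧
      Represents (fun n : ℕ => γ n) v ∧ S = Set.range γ

/-- `o` is an `L`-pole: each point of `X` is within distance `L` of some geodesic connecting `o`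
to some point of `∂X`. -/
def IsPole {X : Type*} [MetricSpace X] (L : ℝ) (o : X ⊕ Boundary X) : Prop :=
  ∀ x : X, ∃ (v : Boundary X) (S : Set X), IsGeodesicTo S v o ∧ ∃ y ∈ S, dist x y ≤ L

/-- `X` has a pole, in `X` or in `∂X`. -/
def HasPole (X : Type*) [MetricSpace X] : Prop :=
  ∃ L : ℝ, 0 ≤ L ∧ ∃ o : X ⊕ Boundary X, IsPole L o

/-! ### Boundary rigidity -/

/-- `(K, C)`-quasi-isometries. -/
def IsQuasiIsometryWith {X Y : Type*} [MetricSpace X] [MetricSpace Y] (K C : ℝ) (f : X → Y) :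
    Prop :=
  (∀ x y : X, K⁻¹ * dist x y - C ≤ dist (f x) (f y) ∧ dist (f x) (f y) ≤ K * dist x y + C) ∧
    ∀ y : Y, ∃ x : X, dist y (f x) ≤ C

/-- Quasi-isometries. -/
def IsQuasiIsometry {X Y : Type*} [MetricSpace X] [MetricSpace Y] (f : X → Y) : Prop :=
  ∃ K C : ℝ, 1 ≤ K ∧ 0 ≤ C ∧ IsQuasiIsometryWith K C f

/-- `g = ∂f`, that is, `g` sends the class of `(u i)` to the class of `(f (u i))`. -/
def IsBoundaryMap {X Y : Type*} [MetricSpace X] [MetricSpace Y] (f : X → Y)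
    (g : Boundary X → Boundary Y) : Prop :=
  ∀ (u : ℕ → X) (ξ : Boundary X), Represents u ξ → Represents (fun i => f (u i)) (g ξ)

/-- Every self quasi-isometry whose induced map on `∂X` is the identity has finite
displacement. -/
def IsBoundaryRigid (X : Type*) [MetricSpace X] : Prop :=
  ∀ f : X → X, IsQuasiIsometry f → IsBoundaryMap f (id : Boundary X → Boundary X) →
    BddAbove (Set.range fun x : X => dist x (f x))

/-! ### Visual metrics and uniform perfectness -/

/-- The Gromov product `(ξ|ζ)_w ∈ [0, ∞]` of boundary points: the infimum of
`liminf (x i | y i)_w` over all sequences `x ∈ ξ` and `y ∈ ζ`. -/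
def bdryProd {X : Type*} [MetricSpace X] (w : X) (ξ ζ : Boundary X) : EReal :=
  sInf {r : EReal | ∃ x y : ℕ → X, Represents x ξ ∧ Represents y ζ ∧
    r = liminf (fun i : ℕ => ((gromovProd w (x i) (y i) : ℝ) : EReal)) atTop}

open Classical in
/-- `ρ_{w,ε}(ξ, ζ) = exp (-ε (ξ|ζ)_w)`, with the convention `exp (-∞) = 0`. -/
def visualRho {X : Type*} [MetricSpace X] (w : X) (ε : ℝ) (ξ ζ : Boundary X) : ℝ :=
  if bdryProd w ξ ζ = ⊤ then 0 else Real.exp (-ε * (bdryProd w ξ ζ).toReal)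

/-- The visual metric `d_{w,ε}` on `∂X`: the infimum of `∑ ρ_{w,ε}(ξ_{i-1}, ξ_i)` over all finite
chains from `ξ` to `ζ`. -/
def visualDist {X : Type*} [MetricSpace X] (w : X) (ε : ℝ) (ξ ζ : Boundary X) : ℝ :=
  sInf {r : ℝ | ∃ (n : ℕ) (c : ℕ → Boundary X), 1 ≤ n ∧ c 0 = ξ ∧ c n = ζ ∧
    r = ∑ i ∈ Finset.range n, visualRho w ε (c i) (c (i + 1))}

/-- Uniform perfectness of a set `Z` with respect to a metric `d` on it. -/
def IsUniformlyPerfect {Z : Type*} (d : Z → Z → ℝ) : Prop :=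
  ∃ S : ℝ, 1 ≤ S ∧ ∃ r₀ : ℝ, 0 < r₀ ∧ ∀ x : Z, ∀ r : ℝ, 0 < r → r ≤ r₀ →
    ∃ y : Z, r / S < d x y ∧ d x y ≤ r

/-! ### Geodesic richness -/

/-- The distance between two sets, `inf {dist a b | a ∈ A, b ∈ B}`. -/
def setDist {X : Type*} [MetricSpace X] (A B : Set X) : ℝ :=
  sInf (Set.image2 dist A B)

/-- Geodesic richness in the sense of Shchur. -/
def IsGeodesicallyRich (X : Type*) [MetricSpace X] : Prop :=
  ∃ r₀ r₁ r₂ r₃ r₄ : ℝ,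
    (∀ p q : X, r₀ ≤ dist p q → ∃ γ : ℝ → X, IsLine γ ∧
      Metric.infDist p (Set.range γ) < r₁ ∧
      |Metric.infDist q (Set.range γ) - dist p q| < r₂) ∧
    (∀ γ : ℝ → X, IsLine γ → ∀ p : X, ∃ γ' : ℝ → X, IsLine γ' ∧
      Metric.infDist p (Set.range γ') < r₃ ∧
      |Metric.infDist p (Set.range γ) - setDist (Set.range γ') (Set.range γ)| < r₄)

end Hyp

end

/-!
All three properties are equivalent to a statement about geodesic rays from the base point `w`
(`RaysBranch`): there is an `N` such that from each ray and after any time another ray branches off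
within time `N`. Thin triangles give the four-point inequality for Gromov products (`FourPoint`,
with constant `3 * δ`), on which everything else rests. Compactness turns every boundary point into
a ray from `w` and moves the pole, wherever it is, to `w` (`HasPole.exists_isRayPole`): every point
is uniformly close to a ray from `w`.

*Uniform perfectness.* Since `ε < 1 / (5 * δ)`, the function `exp (-ε (ξ|ζ)_w)` is a
quasi-ultrametric with constant less than `2`, so by Frink's lemma (`frink`) it is comparable to the
visual metric. An annulus around `ξ` in the visual metric thus corresponds to a bounded time
interval on a ray to `ξ`.

*Branching implies rigidity and richness.* If rays branch, every point of `X` is a coarse center of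
an ideal triangle (`FourPoint.hasTripods`). By stability of quasi-geodesics
(`FourPoint.exists_quasiGeodesic_close`), a quasi-isometry that fixes the boundary maps a center of
an ideal triangle to a center of the same triangle. Centers are coarsely unique, so the displacement
is bounded. Also, given a center `p` and a point `q`, at most one vertex of the triangle lies in
the direction of `q`; the side between two other vertices is a line through `p` that leads away from
`q`, and such lines give both parts of geodesic richness.

*Richness implies branching.* A line that passes near a point `σ s` of a ray, but essentially no
closer to `w` than that point, has two ends that follow `σ` until time `s`, and one of them has to
leave it there (`IsGeodesicallyRich.exists_raysBranch`).

*Rigidity implies branching.* If rays do not branch uniformly, there are ever longer segments of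
rays along which nothing branches off. Near such a segment `X` looks like an interval (a tube). The
map that compresses the first part of each tube and stretches the rest (`TubeFamily.stretch`,
`TubeFamily.push`) is a quasi-isometry which fixes the boundary but has unbounded displacement.
-/

namespace Hyp

variable {X : Type*} [MetricSpace X]

/-! ### Gromov products -/

theorem gromovProd_comm (w x y : X) : gromovProd w x y = gromovProd w y x := by
  simp only [gromovProd, dist_comm x y]; ring

theorem gromovProd_nonneg (w x y : X) : 0 ≤ gromovProd w x y := by
  have := dist_triangle_right x y w
  simp only [gromovProd]; linarith

theorem gromovProd_le_left (w x y : X) : gromovProd w x y ≤ dist x w := by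
  have := dist_triangle_left y w x
  simp only [gromovProd]; linarith

theorem gromovProd_self (w x : X) : gromovProd w x x = dist x w := by
  simp [gromovProd]

theorem gromovProd_add_gromovProd (x y a : X) :
    gromovProd x a y + gromovProd y a x = dist x y := by
  simp only [gromovProd, dist_comm y x]; ring

theorem gromovProd_le_gromovProd_add_dist_base (w w' x y : X) :
    gromovProd w x y ≤ gromovProd w' x y + dist w w' := by
  have h1 := dist_triangle_right x w w'
  have h2 := dist_triangle_right y w w'
  simp only [gromovProd]; linarith

theorem gromovProd_le_gromovProd_add_dist_left (w x x' y : X) :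
    gromovProd w x y ≤ gromovProd w x' y + dist x x' := by
  have h1 := dist_triangle x x' w
  have h2 := dist_triangle_left x' y x
  simp only [gromovProd]; linarith

theorem gromovProd_le_gromovProd_add_dist_right (w x y y' : X) :
    gromovProd w x y ≤ gromovProd w x y' + dist y y' := by
  rw [gromovProd_comm w x y, gromovProd_comm w x y']
  exact gromovProd_le_gromovProd_add_dist_left w y y' x

theorem gromovProd_le_dist_of_between {w x y p : X} (hp : dist x p + dist p y = dist x y) :
    gromovProd w x y ≤ dist p w := by
  have h1 := dist_triangle x p w
  have h2 := dist_triangle_left y w p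
  simp only [gromovProd]; linarith

/-! ### Geodesics -/

/-- `γ` restricted to `[0, dist x y]` is a geodesic from `x` to `y`. -/
def IsGeodesic (γ : ℝ → X) (x y : X) : Prop :=
  γ 0 = x ∧ γ (dist x y) = y ∧
    ∀ s ∈ Set.Icc 0 (dist x y), ∀ t ∈ Set.Icc 0 (dist x y), dist (γ s) (γ t) = |s - t|

theorem IsGeodesicSpace.exists_isGeodesic (hgeo : IsGeodesicSpace X) (x y : X) :
    ∃ γ : ℝ → X, IsGeodesic γ x y := by
  obtain ⟨_, γ, h0, h1, h2, -⟩ := hgeo x y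
  exact ⟨γ, h0, h1, h2⟩

theorem IsGeodesic.isSegment {γ : ℝ → X} {x y : X} (h : IsGeodesic γ x y) :
    IsSegment (γ '' Set.Icc 0 (dist x y)) x y :=
  ⟨γ, h.1, h.2.1, h.2.2, rfl⟩

theorem IsGeodesic.dist_left {γ : ℝ → X} {x y : X} (h : IsGeodesic γ x y) {t : ℝ}
    (ht : t ∈ Set.Icc 0 (dist x y)) : dist x (γ t) = t := by
  have := h.2.2 0 ⟨le_rfl, dist_nonneg⟩ t ht
  rw [h.1] at this
  rw [this, zero_sub, abs_neg, abs_of_nonneg ht.1]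

theorem IsGeodesic.dist_right {γ : ℝ → X} {x y : X} (h : IsGeodesic γ x y) {t : ℝ}
    (ht : t ∈ Set.Icc 0 (dist x y)) : dist (γ t) y = dist x y - t := by
  have := h.2.2 t ht (dist x y) ⟨dist_nonneg, le_rfl⟩
  rw [h.2.1] at this
  rw [this, abs_sub_comm, abs_of_nonneg (by linarith [ht.2])]

theorem IsGeodesic.between {γ : ℝ → X} {x y : X} (h : IsGeodesic γ x y) {t : ℝ}
    (ht : t ∈ Set.Icc 0 (dist x y)) : dist x (γ t) + dist (γ t) y = dist x y := by
  rw [h.dist_left ht, h.dist_right ht]; ring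

theorem continuousOn_of_dist_eq {γ : ℝ → X} {S : Set ℝ}
    (h : ∀ s ∈ S, ∀ t ∈ S, dist (γ s) (γ t) = |s - t|) : ContinuousOn γ S := by
  have : LipschitzOnWith 1 γ S := LipschitzOnWith.of_dist_le_mul fun s hs t ht => by
    rw [h s hs t ht, Real.dist_eq]; simp
  exact this.continuousOn

theorem IsGeodesic.continuousOn {γ : ℝ → X} {x y : X} (h : IsGeodesic γ x y) :
    ContinuousOn γ (Set.Icc 0 (dist x y)) :=
  continuousOn_of_dist_eq h.2.2

theorem IsGeodesic.isCompact_image {γ : ℝ → X} {x y : X} (h : IsGeodesic γ x y) :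
    IsCompact (γ '' Set.Icc 0 (dist x y)) :=
  isCompact_Icc.image_of_continuousOn h.continuousOn

/-! ### Thin triangles and the four-point inequality -/

/-- The four-point form of hyperbolicity, for Gromov products with respect to all base points. -/
def FourPoint (h : ℝ) (X : Type*) [MetricSpace X] : Prop :=
  ∀ w x y z : X, min (gromovProd w x y) (gromovProd w y z) - h ≤ gromovProd w x z

/-- In a thin triangle `x, y, w` the side from `x` to `y` has a point that is `δ`-close to both
other sides, because the two closed sets of points close to one of them cover the side. -/
theorem IsHyperbolic.exists_close_to_both_sides {δ : ℝ} (hδ : 0 ≤ δ) (hhyp : IsHyperbolic δ X)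
    {w x y : X} {α β γ : ℝ → X} (hα : IsGeodesic α x w) (hβ : IsGeodesic β y w)
    (hγ : IsGeodesic γ x y) :
    ∃ t ∈ Set.Icc 0 (dist x y), (∃ a ∈ Set.Icc 0 (dist x w), dist (γ t) (α a) ≤ δ) ∧
      ∃ b ∈ Set.Icc 0 (dist y w), dist (γ t) (β b) ≤ δ := by
  set P := γ '' Set.Icc 0 (dist x y)
  set A := α '' Set.Icc 0 (dist x w)
  set B := β '' Set.Icc 0 (dist y w)
  have hA : IsCompact A := hα.isCompact_image
  have hB : IsCompact B := hβ.isCompact_image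
  have hxA : x ∈ A := ⟨0, ⟨le_rfl, dist_nonneg⟩, hα.1⟩
  have hyB : y ∈ B := ⟨0, ⟨le_rfl, dist_nonneg⟩, hβ.1⟩
  have hxP : x ∈ P := ⟨0, ⟨le_rfl, dist_nonneg⟩, hγ.1⟩
  have hyP : y ∈ P := ⟨dist x y, ⟨dist_nonneg, le_rfl⟩, hγ.2.1⟩
  have hP : IsPreconnected P := isPreconnected_Icc.image _ hγ.continuousOn
  have hcover : P ⊆ {p | Metric.infDist p A ≤ δ} ∪ {p | Metric.infDist p B ≤ δ} := by
    intro p hp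
    obtain ⟨q, hq | hq, hpq⟩ := hhyp x y w P B A hγ.isSegment hβ.isSegment hα.isSegment p hp
    · exact Or.inr ((Metric.infDist_le_dist_of_mem hq).trans hpq)
    · exact Or.inl ((Metric.infDist_le_dist_of_mem hq).trans hpq)
  obtain ⟨p, ⟨t, ht, rfl⟩, hpA, hpB⟩ := isPreconnected_closed_iff.1 hP _ _
    (isClosed_le (Metric.continuous_infDist_pt A) continuous_const)
    (isClosed_le (Metric.continuous_infDist_pt B) continuous_const) hcover
    ⟨x, hxP, by simpa [Metric.infDist_zero_of_mem hxA] using hδ⟩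
    ⟨y, hyP, by simpa [Metric.infDist_zero_of_mem hyB] using hδ⟩
  obtain ⟨_, ⟨a, ha, rfl⟩, hpa⟩ := hA.exists_infDist_eq_dist ⟨x, hxA⟩ (γ t)
  obtain ⟨_, ⟨b, hb, rfl⟩, hpb⟩ := hB.exists_infDist_eq_dist ⟨y, hyB⟩ (γ t)
  exact ⟨t, ht, ⟨a, ha, hpa ▸ hpA⟩, ⟨b, hb, hpb ▸ hpB⟩⟩

/-- The Gromov product `(x|y)_w` is, up to `2δ`, the distance from `w` to a geodesic from `x` to
`y`. The opposite inequality is `gromovProd_le_dist_of_between`. -/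
theorem IsHyperbolic.exists_dist_le_gromovProd {δ : ℝ} (hδ : 0 ≤ δ) (hhyp : IsHyperbolic δ X)
    (hgeo : IsGeodesicSpace X) (w : X) {x y : X} {γ : ℝ → X} (hγ : IsGeodesic γ x y) :
    ∃ t ∈ Set.Icc 0 (dist x y), dist (γ t) w ≤ gromovProd w x y + 2 * δ := by
  obtain ⟨α, hα⟩ := hgeo.exists_isGeodesic x w
  obtain ⟨β, hβ⟩ := hgeo.exists_isGeodesic y w
  obtain ⟨t, ht, ⟨a, ha, hta⟩, ⟨b, hb, htb⟩⟩ := hhyp.exists_close_to_both_sides hδ hα hβ hγ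
  refine ⟨t, ht, ?_⟩
  have h1 := hα.between ha
  have h2 := hβ.between hb
  have h3 := hγ.between ht
  have h4 := dist_triangle (γ t) (α a) w
  have h5 := dist_triangle (γ t) (β b) w
  have h6 := dist_triangle_right x (γ t) (α a)
  have h7 := dist_triangle_right y (γ t) (β b)
  have h8 := dist_comm (γ t) y
  simp only [gromovProd]
  linarith

theorem FourPoint.le {h : ℝ} (H : FourPoint h X) {w x y z : X} {M : ℝ}
    (h1 : M ≤ gromovProd w x y) (h2 : M ≤ gromovProd w y z) : M - h ≤ gromovProd w x z := by
  have h3 := H w x y z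
  have h4 := le_min h1 h2
  linarith

theorem FourPoint.lt {h : ℝ} (H : FourPoint h X) {w x y z : X} {M : ℝ}
    (h1 : M < gromovProd w x y) (h2 : M < gromovProd w y z) : M - h < gromovProd w x z := by
  have h3 := H w x y z
  have h4 := lt_min h1 h2
  linarith

theorem IsHyperbolic.fourPoint {δ : ℝ} (hδ : 0 ≤ δ) (hhyp : IsHyperbolic δ X)
    (hgeo : IsGeodesicSpace X) : FourPoint (3 * δ) X := by
  intro w x y z
  obtain ⟨γ, hγ⟩ := hgeo.exists_isGeodesic x z
  obtain ⟨α, hα⟩ := hgeo.exists_isGeodesic x y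
  obtain ⟨β, hβ⟩ := hgeo.exists_isGeodesic z y
  obtain ⟨t, ht, htw⟩ := hhyp.exists_dist_le_gromovProd hδ hgeo w hγ
  obtain ⟨_, ⟨b, hb, rfl⟩ | ⟨a, ha, rfl⟩, hq⟩ := hhyp x z y _ _ _ hγ.isSegment hβ.isSegment
    hα.isSegment (γ t) ⟨t, ht, rfl⟩
  · have h1 := gromovProd_le_dist_of_between (w := w) (hβ.between hb)
    have h2 := dist_triangle_left (β b) w (γ t)
    have h3 := min_le_right (gromovProd w x y) (gromovProd w y z)
    rw [gromovProd_comm w y z] at h3 ⊢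
    linarith
  · have h1 := gromovProd_le_dist_of_between (w := w) (hα.between ha)
    have h2 := dist_triangle_left (α a) w (γ t)
    have h3 := min_le_left (gromovProd w x y) (gromovProd w y z)
    linarith

/-! ### Convergence to the boundary -/

theorem tendsto_gromovProd_of_base {ι : Type*} {l : Filter ι} {x y : ι → X} {w : X} (w' : X)
    (h : Tendsto (fun i => gromovProd w (x i) (y i)) l atTop) :
    Tendsto (fun i => gromovProd w' (x i) (y i)) l atTop := by
  refine tendsto_atTop_mono (fun i => ?_) (tendsto_atTop_add_const_right l (-dist w w') h)
  have := gromovProd_le_gromovProd_add_dist_base w w' (x i) (y i)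
  linarith

theorem FourPoint.tendsto_trans {h : ℝ} (H : FourPoint h X) {ι : Type*} {l : Filter ι}
    {x y z : ι → X} {w : X} (h1 : Tendsto (fun i => gromovProd w (x i) (y i)) l atTop)
    (h2 : Tendsto (fun i => gromovProd w (y i) (z i)) l atTop) :
    Tendsto (fun i => gromovProd w (x i) (z i)) l atTop := by
  refine tendsto_atTop.2 fun M => ?_
  filter_upwards [tendsto_atTop.1 h1 (M + h), tendsto_atTop.1 h2 (M + h)] with i h1 h2
  have := H w (x i) (y i) (z i)
  have := le_min h1 h2
  linarith

theorem tendsto_gromovProd_swap {ι : Type*} {l : Filter ι} {x y : ι → X} {w : X}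
    (h : Tendsto (fun i => gromovProd w (x i) (y i)) l atTop) :
    Tendsto (fun i => gromovProd w (y i) (x i)) l atTop := by
  simpa only [gromovProd_comm] using h

theorem IsGromovSeq.tendsto_dist {u : ℕ → X} (hu : IsGromovSeq u) (w : X) :
    Tendsto (fun i => dist (u i) w) atTop atTop := by
  have h1 : Tendsto (fun i : ℕ => (i, i)) atTop atTop := by
    rw [← prod_atTop_atTop_eq]; exact tendsto_id.prodMk tendsto_id
  have := (hu w).comp h1
  simpa only [Function.comp_def, gromovProd_self] using this

theorem isGromovSeq_of_base {u : ℕ → X} {w : X}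
    (h : Tendsto (fun p : ℕ × ℕ => gromovProd w (u p.1) (u p.2)) atTop atTop) :
    IsGromovSeq u :=
  fun w' => tendsto_gromovProd_of_base w' h

/-- In a hyperbolic space the relation that defines the boundary is an equivalence relation, so
sequences with the same class are equivalent. -/
theorem FourPoint.tendsto_of_represents {h : ℝ} (H : FourPoint h X) {u v : ℕ → X}
    {ξ : Boundary X} (hu : Represents u ξ) (hv : Represents v ξ) (w : X) :
    Tendsto (fun i => gromovProd w (u i) (v i)) atTop atTop := by
  obtain ⟨hu, rfl⟩ := hu
  obtain ⟨hv, hvu⟩ := hv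
  have hequiv : Equivalence (GromovSeq.Equivalent (X := X)) :=
    ⟨fun u w => by simpa only [gromovProd_self] using u.2.tendsto_dist w,
      fun h w => tendsto_gromovProd_swap (h w), fun h1 h2 w => H.tendsto_trans (h1 w) (h2 w)⟩
  exact hequiv.symm (hequiv.eqvGen_iff.1 (Quot.eqvGen_exact hvu)) w

theorem FourPoint.represents_of_tendsto {h : ℝ} (H : FourPoint h X) {u v : ℕ → X}
    {ξ : Boundary X} {w : X} (hu : Represents u ξ)
    (huv : Tendsto (fun i => gromovProd w (u i) (v i)) atTop atTop) : Represents v ξ := by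
  obtain ⟨hu, rfl⟩ := hu
  have hv : IsGromovSeq v := by
    refine isGromovSeq_of_base (w := w) ?_
    have h1 := huv.comp (tendsto_fst (f := atTop) (g := (atTop : Filter ℕ)))
    have h2 := huv.comp (tendsto_snd (f := (atTop : Filter ℕ)) (g := atTop))
    rw [prod_atTop_atTop_eq] at h1 h2
    exact H.tendsto_trans (H.tendsto_trans (tendsto_gromovProd_swap h1) (hu w)) h2
  refine ⟨hv, Quot.sound fun w' => ?_⟩
  exact tendsto_gromovProd_swap (tendsto_gromovProd_of_base w' huv)

theorem exists_represents (ξ : Boundary X) : ∃ u : ℕ → X, Represents u ξ := by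
  obtain ⟨⟨u, hu⟩, rfl⟩ := Quot.exists_rep ξ
  exact ⟨u, hu, rfl⟩

/-! ### Geodesic rays and lines -/

theorem IsRay.dist_eq {σ : ℝ → X} {w : X} (hσ : IsRay σ w) {t : ℝ} (ht : 0 ≤ t) :
    dist (σ t) w = t := by
  have := hσ.2 t ht 0 (Set.mem_Ici.2 le_rfl)
  rwa [hσ.1, sub_zero, abs_of_nonneg ht] at this

theorem IsRay.gromovProd_eq {σ : ℝ → X} {w : X} (hσ : IsRay σ w) {s t : ℝ} (hs : 0 ≤ s)
    (ht : 0 ≤ t) : gromovProd w (σ s) (σ t) = min s t := by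
  rw [gromovProd, hσ.dist_eq hs, hσ.dist_eq ht, hσ.2 s hs t ht]
  rcases le_total s t with h | h
  · rw [min_eq_left h, abs_of_nonpos (by linarith)]; ring
  · rw [min_eq_right h, abs_of_nonneg (by linarith)]; ring

theorem tendsto_natCast_min :
    Tendsto (fun p : ℕ × ℕ => min (p.1 : ℝ) (p.2 : ℝ)) atTop atTop := by
  refine tendsto_atTop.2 fun M => ?_
  obtain ⟨N, hN⟩ := exists_nat_ge M
  filter_upwards [eventually_ge_atTop (N, N)] with p hp
  exact le_min (hN.trans (by exact_mod_cast hp.1)) (hN.trans (by exact_mod_cast hp.2))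

theorem IsRay.isGromovSeq {σ : ℝ → X} {w : X} (hσ : IsRay σ w) :
    IsGromovSeq (fun n : ℕ => σ n) := by
  refine isGromovSeq_of_base (w := w) ?_
  simpa only [hσ.gromovProd_eq (Nat.cast_nonneg _) (Nat.cast_nonneg _)] using tendsto_natCast_min

/-- Gromov products based at the common origin increase along two rays. -/
theorem IsRay.gromovProd_mono {σ η : ℝ → X} {w : X} (hσ : IsRay σ w) (hη : IsRay η w)
    {s s' t t' : ℝ} (hs : 0 ≤ s) (ht : 0 ≤ t) (hss : s ≤ s') (htt : t ≤ t') :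
    gromovProd w (σ s) (η t) ≤ gromovProd w (σ s') (η t') := by
  have h1 := hσ.2 s hs s' (hs.trans hss)
  have h2 := hη.2 t ht t' (ht.trans htt)
  rw [abs_of_nonpos (by linarith)] at h1 h2
  have h3 := dist_triangle4 (σ s') (σ s) (η t) (η t')
  rw [dist_comm (σ s') (σ s)] at h3
  rw [gromovProd, gromovProd, hσ.dist_eq hs, hη.dist_eq ht, hσ.dist_eq (hs.trans hss),
    hη.dist_eq (ht.trans htt)]
  linarith

theorem exists_tendsto_of_bounded [ProperSpace X] (F : Ultrafilter ℕ) (g : ℕ → ℝ → X) (p : X)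
    (R : ℝ → ℝ) (hg : ∀ t, ∀ᶠ n in (F : Filter ℕ), dist (g n t) p ≤ R t) :
    ∃ γ : ℝ → X, ∀ t, Tendsto (fun n => g n t) F (𝓝 (γ t)) := by
  have : ∀ t, ∃ x, Tendsto (fun n => g n t) F (𝓝 x) := by
    intro t
    obtain ⟨x, -, hx⟩ := (isCompact_closedBall p (R t)).ultrafilter_le_nhds
      (F.map fun n => g n t) (le_principal_iff.2 (hg t))
    exact ⟨x, hx⟩
  choose γ hγ using this
  exact ⟨γ, hγ⟩

/-- Every Gromov sequence is equivalent to a ray with prescribed origin, obtained as a limit of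
the geodesics from that origin to the points of the sequence. -/
theorem FourPoint.exists_isRay [ProperSpace X] {h : ℝ} (H : FourPoint h X)
    (hgeo : IsGeodesicSpace X) (w : X) {u : ℕ → X} (hu : IsGromovSeq u) :
    ∃ σ : ℝ → X, IsRay σ w ∧ Tendsto (fun n : ℕ => gromovProd w (σ n) (u n)) atTop atTop := by
  choose g hg using fun n => hgeo.exists_isGeodesic w (u n)
  set F := hyperfilter ℕ
  have hF : (F : Filter ℕ) ≤ atTop := Nat.hyperfilter_le_atTop
  have hlong : ∀ t, 0 ≤ t → ∀ᶠ n in (F : Filter ℕ), t ∈ Set.Icc 0 (dist w (u n)) := by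
    intro t ht
    filter_upwards [hF (tendsto_atTop.1 (hu.tendsto_dist w) t)] with n hn
    exact ⟨ht, by rwa [dist_comm]⟩
  obtain ⟨σ, hσ⟩ := exists_tendsto_of_bounded F (fun n t => g n (max t 0)) w (fun t => max t 0)
    (fun t => by
      filter_upwards [hlong (max t 0) (le_max_right _ _)] with n hn
      rw [dist_comm, (hg n).dist_left hn])
  have hσ' : ∀ t, 0 ≤ t → Tendsto (fun n => g n t) F (𝓝 (σ t)) := fun t ht => by
    simpa only [max_eq_left ht] using hσ t
  have hray : IsRay σ w := by
    refine ⟨tendsto_nhds_unique (hσ' 0 le_rfl) ?_, fun s hs t ht => ?_⟩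
    · simp only [(hg _).1]; exact tendsto_const_nhds
    · refine tendsto_nhds_unique ((hσ' s hs).dist (hσ' t ht)) (tendsto_const_nhds.congr' ?_)
      filter_upwards [hlong s hs, hlong t ht] with n h1 h2
      exact ((hg n).2.2 s h1 t h2).symm
  refine ⟨σ, hray, tendsto_atTop.2 fun M => ?_⟩
  obtain ⟨⟨N1, N2⟩, hN⟩ := eventually_atTop.1 (tendsto_atTop.1 (hu w) (M + h))
  obtain ⟨N3, hN3⟩ := exists_nat_ge (M + h + 1)
  filter_upwards [eventually_ge_atTop (max N2 N3)] with m hm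
  have hclose : ∀ᶠ n in (F : Filter ℕ), dist (σ m) (g n m) < 1 := by
    filter_upwards [(hσ' m (Nat.cast_nonneg m)).eventually (Metric.ball_mem_nhds _ one_pos)]
      with n hn
    rwa [dist_comm]
  obtain ⟨n, hn1, hn2, hn3⟩ := (hclose.and ((hlong m (Nat.cast_nonneg m)).and
    (hF (eventually_ge_atTop N1)))).exists
  have h1 : gromovProd w (g n m) (u n) = m := by
    rw [gromovProd, dist_comm _ w, (hg n).dist_left hn2, dist_comm _ w, (hg n).dist_right hn2]
    ring
  have h2 := gromovProd_le_gromovProd_add_dist_left w (g n m) (σ m) (u n)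
  rw [dist_comm] at h2
  have h3 := hN (n, m) ⟨hn3, (le_max_left _ _).trans hm⟩
  have h4 : (N3 : ℝ) ≤ m := by exact_mod_cast (le_max_right _ _).trans hm
  have h5 := H w (σ m) (u n) (u m)
  have h6 : M + h ≤ min (gromovProd w (σ m) (u n)) (gromovProd w (u n) (u m)) :=
    le_min (by linarith) h3
  linarith

theorem FourPoint.exists_isRay_represents [ProperSpace X] {h : ℝ} (H : FourPoint h X)
    (hgeo : IsGeodesicSpace X) (w : X) (ξ : Boundary X) :
    ∃ σ : ℝ → X, IsRay σ w ∧ Represents (fun n : ℕ => σ n) ξ := by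
  obtain ⟨u, hu⟩ := exists_represents ξ
  obtain ⟨σ, hσ, hσu⟩ := H.exists_isRay hgeo w hu.1
  exact ⟨σ, hσ, H.represents_of_tendsto hu (tendsto_gromovProd_swap hσu)⟩

/-- Two sequences that diverge and keep bounded Gromov product at `p` give a line through a
neighbourhood of `p`, all of whose points are close to geodesics between the two sequences. -/
theorem exists_isLine_of_gromovProd_le [ProperSpace X] {δ : ℝ} (hδ : 0 ≤ δ)
    (hhyp : IsHyperbolic δ X) (hgeo : IsGeodesicSpace X) {a b : ℕ → X} {p : X} {C : ℝ}
    (ha : Tendsto (fun n => dist (a n) p) atTop atTop)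
    (hb : Tendsto (fun n => dist (b n) p) atTop atTop)
    (hab : ∀ n, gromovProd p (a n) (b n) ≤ C) :
    ∃ γ : ℝ → X, IsLine γ ∧ dist (γ 0) p ≤ C + 2 * δ ∧ ∀ t, ∃ n y,
      dist (a n) y + dist y (b n) = dist (a n) (b n) ∧ dist y (γ t) ≤ 1 := by
  choose g hg using fun n => hgeo.exists_isGeodesic (a n) (b n)
  choose τ hτ hτp using fun n => hhyp.exists_dist_le_gromovProd hδ hgeo p (hg n)
  replace hτp : ∀ n, dist (g n (τ n)) p ≤ C + 2 * δ := fun n => (hτp n).trans (by linarith [hab n])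
  set F := hyperfilter ℕ
  have hF : (F : Filter ℕ) ≤ atTop := Nat.hyperfilter_le_atTop
  have hlong : ∀ t, ∀ᶠ n in (F : Filter ℕ), τ n + t ∈ Set.Icc 0 (dist (a n) (b n)) := by
    intro t
    filter_upwards [hF (tendsto_atTop.1 ha (C + 2 * δ + |t|)),
      hF (tendsto_atTop.1 hb (C + 2 * δ + |t|))] with n h1 h2
    have h3 := (hg n).dist_left (hτ n)
    have h4 := (hg n).dist_right (hτ n)
    have h5 := dist_triangle (a n) (g n (τ n)) p
    have h6 := dist_triangle_left (b n) p (g n (τ n))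
    have h7 := hτp n
    have h8 := abs_le.1 (le_refl |t|)
    exact ⟨by linarith, by linarith⟩
  obtain ⟨γ, hγ⟩ := exists_tendsto_of_bounded F (fun n t => g n (τ n + t)) p
    (fun t => C + 2 * δ + |t|) (fun t => by
      filter_upwards [hlong t] with n hn
      have h1 := (hg n).2.2 _ hn _ (hτ n)
      rw [add_sub_cancel_left] at h1
      have h2 := dist_triangle (g n (τ n + t)) (g n (τ n)) p
      have h7 := hτp n
      linarith)
  refine ⟨γ, Isometry.of_dist_eq fun s t => ?_, ?_, fun t => ?_⟩
  · refine tendsto_nhds_unique ((hγ s).dist (hγ t)) (tendsto_const_nhds.congr' ?_)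
    filter_upwards [hlong s, hlong t] with n h1 h2
    rw [(hg n).2.2 _ h1 _ h2, add_sub_add_left_eq_sub, Real.dist_eq]
  · refine le_of_tendsto ((hγ 0).dist tendsto_const_nhds) (Eventually.of_forall fun n => ?_)
    simpa using hτp n
  · obtain ⟨n, h1, h2⟩ := ((hlong t).and
      ((hγ t).eventually (Metric.ball_mem_nhds _ one_pos))).exists
    exact ⟨n, _, (hg n).between h1, le_of_lt h2⟩

/-! ### Rays from an arbitrary base point -/

/-- Every point `x` is `L`-close to a ray that starts at `w`, namely to the point of the ray at the
same distance from `w` as `x`. -/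
def IsRayPole (L : ℝ) (w : X) : Prop :=
  ∀ x : X, ∃ σ : ℝ → X, IsRay σ w ∧ dist x (σ (dist x w)) ≤ L

/-- A point that lies, up to an error `c`, between `w` and points far out in a Gromov sequence is
close to a ray from `w` that is equivalent to the sequence. -/
theorem FourPoint.dist_ray_le {h : ℝ} (H : FourPoint h X) {w x : X} {c : ℝ} {u : ℕ → X}
    {σ : ℝ → X} (hσ : IsRay σ w)
    (hσu : Tendsto (fun n : ℕ => gromovProd w (σ n) (u n)) atTop atTop)
    (hx : ∃ᶠ n in atTop, dist x w - c ≤ gromovProd w x (u n)) (hc : 0 ≤ c) (hh : 0 ≤ h) :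
    dist x (σ (dist x w)) ≤ 2 * c + 4 * h := by
  obtain ⟨N, hN⟩ := exists_nat_ge (dist x w)
  obtain ⟨n, h1, h2, h3⟩ := (hx.and_eventually ((tendsto_atTop.1 hσu (dist x w)).and
    (eventually_ge_atTop N))).exists
  have hn : dist x w ≤ n := hN.trans (by exact_mod_cast h3)
  have h4 := H w x (u n) (σ n)
  have h5 := H w x (σ n) (σ (dist x w))
  rw [hσ.gromovProd_eq (Nat.cast_nonneg n) dist_nonneg, min_eq_right hn] at h5
  rw [gromovProd_comm] at h2
  have h6 : dist x w - c ≤ min (gromovProd w x (u n)) (gromovProd w (u n) (σ n)) :=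
    le_min h1 (by linarith)
  have h7 : dist x w - c - h ≤ min (gromovProd w x (σ n)) (dist x w) :=
    le_min (by linarith) (by linarith)
  have h8 : dist x w - c - 2 * h ≤ gromovProd w x (σ (dist x w)) := by linarith
  rw [gromovProd, hσ.dist_eq dist_nonneg] at h8
  linarith

/-- A pole, in `X` or at infinity, can be moved to any point of `X`. -/
theorem HasPole.exists_isRayPole [ProperSpace X] {h : ℝ} (H : FourPoint h X) (hh : 0 ≤ h)
    (hgeo : IsGeodesicSpace X) (hpole : HasPole X) (w : X) : ∃ L, 0 ≤ L ∧ IsRayPole L w := by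
  obtain ⟨L, hL, o, ho⟩ := hpole
  -- it suffices to consider the points of the geodesics that the pole provides
  suffices hs : ∃ C, 0 ≤ C ∧ ∀ (v : Boundary X) (S : Set X), IsGeodesicTo S v o → ∀ y ∈ S,
      ∃ σ : ℝ → X, IsRay σ w ∧ dist y (σ (dist y w)) ≤ C by
    obtain ⟨C, hC, hs⟩ := hs
    refine ⟨2 * L + C, by linarith, fun x => ?_⟩
    obtain ⟨v, S, hS, y, hy, hxy⟩ := ho x
    obtain ⟨σ, hσ, hσy⟩ := hs v S hS y hy
    refine ⟨σ, hσ, ?_⟩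
    have h1 := hσ.2 _ (Set.mem_Ici.2 (dist_nonneg (x := y) (y := w))) _
      (Set.mem_Ici.2 (dist_nonneg (x := x) (y := w)))
    have h2 : |dist y w - dist x w| ≤ dist x y := by
      rw [dist_comm x y]; exact abs_dist_sub_le y x w
    have h3 := dist_triangle4 x y (σ (dist y w)) (σ (dist x w))
    linarith
  rcases o with o | o
  · refine ⟨2 * (2 * dist o w) + 4 * h, by positivity, ?_⟩
    rintro v S ⟨γ, hγ, hv, rfl⟩ _ ⟨t, ht, rfl⟩
    obtain ⟨σ, hσ, hσu⟩ := H.exists_isRay hgeo w hv.1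
    refine ⟨σ, hσ, H.dist_ray_le hσ hσu (Eventually.frequently ?_) (by positivity) hh⟩
    obtain ⟨N, hN⟩ := exists_nat_ge t
    filter_upwards [eventually_ge_atTop N] with n hn
    have h1 := gromovProd_le_gromovProd_add_dist_base o w (γ t) (γ n)
    rw [hγ.gromovProd_eq ht (Nat.cast_nonneg n),
      min_eq_left (hN.trans (by exact_mod_cast hn))] at h1
    have h2 := dist_triangle (γ t) o w
    rw [hγ.dist_eq ht] at h2
    linarith
  · refine ⟨2 * h + 4 * h, by positivity, ?_⟩
    rintro v S ⟨γ, hγ, ho', hv, rfl⟩ _ ⟨t, rfl⟩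
    -- one of the two ends of the line lies behind `γ t` as seen from `w`
    have hends : ∀ᶠ n : ℕ in atTop, dist (γ t) w - h ≤ gromovProd w (γ t) (γ n) ∨
        dist (γ t) w - h ≤ gromovProd w (γ t) (γ (-(n : ℝ))) := by
      obtain ⟨N, hN⟩ := exists_nat_ge |t|
      filter_upwards [eventually_ge_atTop N] with n hn
      have hn' : |t| ≤ n := hN.trans (by exact_mod_cast hn)
      have h0 := abs_le.1 hn'
      have h1 : gromovProd (γ t) (γ n) (γ (-(n : ℝ))) = 0 := by
        rw [gromovProd, hγ.dist_eq, hγ.dist_eq, hγ.dist_eq, Real.dist_eq, Real.dist_eq,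
          Real.dist_eq, abs_of_nonneg (by linarith), abs_of_nonpos (by linarith),
          abs_of_nonneg (by linarith)]
        ring
      have h2 := H (γ t) (γ n) w (γ (-(n : ℝ)))
      rw [h1, sub_nonpos, min_le_iff] at h2
      rcases h2 with h2 | h2
      · left
        have := gromovProd_add_gromovProd (γ t) w (γ n)
        rw [gromovProd_comm w] at this
        linarith
      · right
        have := gromovProd_add_gromovProd (γ t) w (γ (-(n : ℝ)))
        rw [gromovProd_comm w, gromovProd_comm (γ t)] at this
        linarith
    rcases frequently_or_distrib.1 hends.frequently with hf | hf
    · obtain ⟨σ, hσ, hσu⟩ := H.exists_isRay hgeo w hv.1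
      exact ⟨σ, hσ, H.dist_ray_le hσ hσu hf hh hh⟩
    · obtain ⟨σ, hσ, hσu⟩ := H.exists_isRay hgeo w ho'.1
      exact ⟨σ, hσ, H.dist_ray_le hσ hσu hf hh hh⟩

/-! ### Frink's metrization lemma -/

/-- Frink's lemma: a `K`-quasi-ultrametric with `K ≤ 2` is bounded by `K` times the length of any
chain in which the inner steps are counted twice. The induction splits a chain at a step
`c p, c (p + 1)` such that the whole is bounded by both `K * ρ (c m) (c (p + 1))` and
`K * ρ (c p) (c n)`; averaging the two bounds costs `K * K / 2 ≤ K`. -/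
theorem frink_chain {Z : Type*} {ρ : Z → Z → ℝ} (h0 : ∀ x y, 0 ≤ ρ x y) {K : ℝ} (hK1 : 1 ≤ K)
    (hK2 : K ≤ 2) (hρ : ∀ x y z, ρ x z ≤ K * max (ρ x y) (ρ y z)) (c : ℕ → Z) (l : ℕ) :
    ∀ m, ρ (c m) (c (m + l + 2)) ≤ K * (2 * ∑ i ∈ Finset.Ico m (m + l + 2), ρ (c i) (c (i + 1)) -
      ρ (c m) (c (m + 1)) - ρ (c (m + l + 1)) (c (m + l + 2))) := by
  induction l using Nat.strong_induction_on with
  | _ l ih =>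
  intro m
  set a := ρ (c m) (c (m + l + 2)) with ha
  have hsum0 : ∀ i j, 0 ≤ ∑ i ∈ Finset.Ico i j, ρ (c i) (c (i + 1)) := fun i j =>
    Finset.sum_nonneg fun _ _ => h0 _ _
  -- the doubled sum minus the end terms still contains both end terms
  have hW : ρ (c m) (c (m + 1)) + ρ (c (m + l + 1)) (c (m + l + 2)) ≤
      2 * ∑ i ∈ Finset.Ico m (m + l + 2), ρ (c i) (c (i + 1)) -
      ρ (c m) (c (m + 1)) - ρ (c (m + l + 1)) (c (m + l + 2)) := by
    rw [Finset.sum_Ico_succ_top (by omega), Finset.sum_eq_sum_Ico_succ_bot (by omega)]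
    have := hsum0 (m + 1) (m + l + 1)
    have e : m + l + 1 + 1 = m + l + 2 := rfl
    rw [e]
    linarith
  have hK0 : 0 ≤ K := by linarith
  classical
  set P : ℕ → Prop := fun p => a ≤ K * ρ (c (m + p)) (c (m + l + 2)) with hP
  have hP0 : P 0 := by
    have := h0 (c m) (c (m + l + 2))
    simp only [hP, add_zero, ← ha] at this ⊢
    nlinarith
  obtain ⟨p, hpl, hp, hp'⟩ : ∃ p, p ≤ l + 1 ∧ P p ∧ (p < l + 1 → ¬ P (p + 1)) :=
    ⟨Nat.findGreatest P (l + 1), Nat.findGreatest_le _, Nat.findGreatest_spec (Nat.zero_le _) hP0,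
      fun h => Nat.findGreatest_is_greatest (Nat.lt_succ_self _) h⟩
  rcases hpl.eq_or_lt with rfl | hlt
  · refine hp.trans (mul_le_mul_of_nonneg_left ?_ hK0)
    have := h0 (c m) (c (m + 1))
    rw [← add_assoc]
    linarith
  have hq : a ≤ K * ρ (c m) (c (m + p + 1)) := by
    have h1 := hρ (c m) (c (m + p + 1)) (c (m + l + 2))
    have h2 := hp' hlt
    simp only [hP, not_le, ← add_assoc] at h2
    rw [mul_max_of_nonneg _ _ hK0] at h1
    rcases le_max_iff.1 h1 with h | h
    · exact h
    · exact absurd h (not_le.2 h2)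
  rcases p with _ | q
  · refine hq.trans (mul_le_mul_of_nonneg_left ?_ hK0)
    have := h0 (c (m + l + 1)) (c (m + l + 2))
    rw [add_zero]
    linarith
  · obtain ⟨r, rfl⟩ : ∃ r, l = q + 1 + r := ⟨l - (q + 1), by omega⟩
    have h1 := ih q (by omega) m
    have h2 := ih r (by omega) (m + q + 1)
    have e1 : m + q + 1 + r + 2 = m + (q + 1 + r) + 2 := by omega
    have e2 : m + q + 1 + r + 1 = m + (q + 1 + r) + 1 := by omega
    have e3 : m + (q + 1) = m + q + 1 := by omega
    have e4 : m + q + 1 + 1 = m + q + 2 := by omega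
    rw [e1, e2, e4] at h2
    simp only [hP, e3] at hp
    rw [e3, e4] at hq
    have hs : ∑ i ∈ Finset.Ico m (m + (q + 1 + r) + 2), ρ (c i) (c (i + 1)) =
        ∑ i ∈ Finset.Ico m (m + q + 1), ρ (c i) (c (i + 1)) +
        ∑ i ∈ Finset.Ico (m + q + 1) (m + (q + 1 + r) + 2), ρ (c i) (c (i + 1)) :=
      (Finset.sum_Ico_consecutive _ (by omega) (by omega)).symm
    rw [Finset.sum_Ico_succ_top (by omega), e4] at h1
    rw [hs]
    set A := ∑ i ∈ Finset.Ico m (m + q + 1), ρ (c i) (c (i + 1))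
    set B := ∑ i ∈ Finset.Ico (m + q + 1) (m + (q + 1 + r) + 2), ρ (c i) (c (i + 1))
    have h3 : 2 * a ≤ K * (ρ (c m) (c (m + q + 2)) +
        ρ (c (m + q + 1)) (c (m + (q + 1 + r) + 2))) := by linarith
    have h4 : K * (ρ (c m) (c (m + q + 2)) + ρ (c (m + q + 1)) (c (m + (q + 1 + r) + 2))) ≤
        2 * (ρ (c m) (c (m + q + 2)) + ρ (c (m + q + 1)) (c (m + (q + 1 + r) + 2))) :=
      mul_le_mul_of_nonneg_right hK2 (add_nonneg (h0 _ _) (h0 _ _))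
    linarith

theorem frink {Z : Type*} {ρ : Z → Z → ℝ} (h0 : ∀ x y, 0 ≤ ρ x y) {K : ℝ} (hK1 : 1 ≤ K)
    (hK2 : K ≤ 2) (hρ : ∀ x y z, ρ x z ≤ K * max (ρ x y) (ρ y z)) (c : ℕ → Z) {n : ℕ}
    (hn : 1 ≤ n) : ρ (c 0) (c n) ≤ 4 * ∑ i ∈ Finset.range n, ρ (c i) (c (i + 1)) := by
  have hsum0 : 0 ≤ ∑ i ∈ Finset.range n, ρ (c i) (c (i + 1)) :=
    Finset.sum_nonneg fun _ _ => h0 _ _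
  obtain rfl | ⟨l, rfl⟩ : n = 1 ∨ ∃ l, n = l + 2 := by
    rcases n with _ | _ | l
    · omega
    · simp
    · exact Or.inr ⟨l, rfl⟩
  · rw [Finset.sum_range_one] at *
    linarith
  · have h1 := frink_chain h0 hK1 hK2 hρ c l 0
    simp only [zero_add, Nat.Ico_zero_eq_range] at h1
    have h2 := h0 (c 0) (c 1)
    have h3 := h0 (c (l + 1)) (c (l + 2))
    set S := ∑ i ∈ Finset.range (l + 2), ρ (c i) (c (i + 1))
    have h4 : K * (2 * S - ρ (c 0) (c 1) - ρ (c (l + 1)) (c (l + 2))) ≤ K * (2 * S) :=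
      mul_le_mul_of_nonneg_left (by linarith) (by linarith)
    have h5 : K * (2 * S) ≤ 2 * (2 * S) := mul_le_mul_of_nonneg_right hK2 (by linarith)
    linarith

/-! ### The visual metric in terms of rays -/

theorem bdryProd_nonneg (w : X) (ξ ζ : Boundary X) : 0 ≤ bdryProd w ξ ζ := by
  refine le_sInf ?_
  rintro _ ⟨x, y, -, -, rfl⟩
  exact le_liminf_of_le (by isBoundedDefault)
    (Eventually.of_forall fun i => by exact_mod_cast gromovProd_nonneg w (x i) (y i))

theorem FourPoint.le_bdryProd {h : ℝ} (H : FourPoint h X) (w : X) {ξ η ζ : Boundary X} {s : ℝ}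
    (h1 : (s : EReal) < bdryProd w ξ η) (h2 : (s : EReal) < bdryProd w η ζ) :
    ((s - h : ℝ) : EReal) ≤ bdryProd w ξ ζ := by
  obtain ⟨y, hy⟩ := exists_represents η
  refine le_sInf ?_
  rintro _ ⟨x, z, hx, hz, rfl⟩
  refine le_liminf_of_le (by isBoundedDefault) ?_
  have h3 := eventually_lt_of_lt_liminf (h1.trans_le (sInf_le ⟨x, y, hx, hy, rfl⟩))
    (by isBoundedDefault)
  have h4 := eventually_lt_of_lt_liminf (h2.trans_le (sInf_le ⟨y, z, hy, hz, rfl⟩))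
    (by isBoundedDefault)
  filter_upwards [h3, h4] with i h3 h4
  have h5 := H w (x i) (y i) (z i)
  have h6 := lt_min (EReal.coe_lt_coe_iff.1 h3) (EReal.coe_lt_coe_iff.1 h4)
  exact EReal.coe_le_coe_iff.2 (by linarith)

theorem FourPoint.le_bdryProd_of_rays {h : ℝ} (H : FourPoint h X) {w : X} {ξ ζ : Boundary X}
    {σ η : ℝ → X} (hσ : IsRay σ w) (hη : IsRay η w) (hσξ : Represents (fun n : ℕ => σ n) ξ)
    (hηζ : Represents (fun n : ℕ => η n) ζ) {s t : ℝ} (ht : 0 ≤ t) (hh : 0 ≤ h)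
    (hs : s ≤ gromovProd w (σ t) (η t)) : ((s - 2 * h : ℝ) : EReal) ≤ bdryProd w ξ ζ := by
  refine le_sInf ?_
  rintro _ ⟨x, y, hx, hy, rfl⟩
  refine le_liminf_of_le (by isBoundedDefault) ?_
  obtain ⟨N, hN⟩ := exists_nat_ge t
  filter_upwards [tendsto_atTop.1 (H.tendsto_of_represents hx hσξ w) s,
    tendsto_atTop.1 (H.tendsto_of_represents hηζ hy w) s, eventually_ge_atTop N] with i h1 h2 h3
  have hi : t ≤ i := hN.trans (by exact_mod_cast h3)
  have h4 := hσ.gromovProd_mono hη ht ht hi hi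
  have h5 := H w (x i) (σ i) (η i)
  have h6 := H w (x i) (η i) (y i)
  have h7 : s ≤ min (gromovProd w (x i) (σ i)) (gromovProd w (σ i) (η i)) :=
    le_min h1 (by linarith)
  have h8 : s - h ≤ min (gromovProd w (x i) (η i)) (gromovProd w (η i) (y i)) :=
    le_min (by linarith) (by linarith)
  exact EReal.coe_le_coe_iff.2 (by linarith)

theorem bdryProd_le_of_rays {w : X} {ξ ζ : Boundary X} {σ η : ℝ → X}
    (hσξ : Represents (fun n : ℕ => σ n) ξ) (hηζ : Represents (fun n : ℕ => η n) ζ) {s : ℝ}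
    (hs : ∀ t, 0 ≤ t → gromovProd w (σ t) (η t) ≤ s) : bdryProd w ξ ζ ≤ s := by
  refine le_trans (b := liminf (fun i : ℕ => ((gromovProd w (σ i) (η i) : ℝ) : EReal)) atTop)
    (sInf_le ⟨_, _, hσξ, hηζ, rfl⟩) ?_
  refine liminf_le_of_le (by isBoundedDefault) fun b hb => ?_
  obtain ⟨i, hi⟩ := hb.exists
  exact hi.trans (EReal.coe_le_coe_iff.2 (hs i (Nat.cast_nonneg i)))

theorem visualRho_nonneg (w : X) (ε : ℝ) (ξ ζ : Boundary X) : 0 ≤ visualRho w ε ξ ζ := by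
  unfold visualRho
  split_ifs
  · exact le_rfl
  · exact (Real.exp_pos _).le

theorem visualRho_le_exp_iff (w : X) {ε : ℝ} (hε : 0 < ε) (ξ ζ : Boundary X) (s : ℝ) :
    visualRho w ε ξ ζ ≤ Real.exp (-ε * s) ↔ (s : EReal) ≤ bdryProd w ξ ζ := by
  have h0 := bdryProd_nonneg w ξ ζ
  unfold visualRho
  split_ifs with h
  · simp [h, (Real.exp_pos _).le]
  · lift bdryProd w ξ ζ to ℝ using ⟨h, fun h' => by simp [h'] at h0⟩ with b
    rw [EReal.toReal_coe, Real.exp_le_exp, EReal.coe_le_coe_iff]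
    constructor
    · intro h; nlinarith
    · intro h; nlinarith

theorem visualRho_lt_exp_iff (w : X) {ε : ℝ} (hε : 0 < ε) (ξ ζ : Boundary X) (s : ℝ) :
    visualRho w ε ξ ζ < Real.exp (-ε * s) ↔ (s : EReal) < bdryProd w ξ ζ := by
  have h0 := bdryProd_nonneg w ξ ζ
  unfold visualRho
  split_ifs with h
  · simp [h, Real.exp_pos]
  · lift bdryProd w ξ ζ to ℝ using ⟨h, fun h' => by simp [h'] at h0⟩ with b
    rw [EReal.toReal_coe, Real.exp_lt_exp, EReal.coe_lt_coe_iff]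
    constructor
    · intro h; nlinarith
    · intro h; nlinarith

theorem FourPoint.visualRho_le_mul_max {h : ℝ} (H : FourPoint h X) (w : X) {ε : ℝ} (hε : 0 < ε)
    (ξ η ζ : Boundary X) : visualRho w ε ξ ζ ≤
      Real.exp (ε * h) * max (visualRho w ε ξ η) (visualRho w ε η ζ) := by
  rw [← div_le_iff₀' (Real.exp_pos _)]
  refine le_of_forall_gt_imp_ge_of_dense fun m hm => ?_
  have hm0 : 0 < m := lt_of_le_of_lt ((visualRho_nonneg w ε ξ η).trans (le_max_left _ _)) hm
  obtain ⟨s, rfl⟩ : ∃ s, m = Real.exp (-ε * s) :=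
    ⟨-Real.log m / ε, by rw [show -ε * (-Real.log m / ε) = Real.log m by field_simp,
      Real.exp_log hm0]⟩
  have h1 := (visualRho_lt_exp_iff w hε ξ η s).1 ((le_max_left _ _).trans_lt hm)
  have h2 := (visualRho_lt_exp_iff w hε η ζ s).1 ((le_max_right _ _).trans_lt hm)
  have h3 := (visualRho_le_exp_iff w hε ξ ζ _).2 (H.le_bdryProd w h1 h2)
  rwa [div_le_iff₀' (Real.exp_pos _), ← Real.exp_add,
    show ε * h + -ε * s = -ε * (s - h) by ring]

theorem visualDist_le_visualRho (w : X) (ε : ℝ) (ξ ζ : Boundary X) :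
    visualDist w ε ξ ζ ≤ visualRho w ε ξ ζ := by
  refine csInf_le ⟨0, ?_⟩ ⟨1, fun n => if n = 0 then ξ else ζ, le_rfl, by simp, by simp, by simp⟩
  rintro _ ⟨n, c, -, -, -, rfl⟩
  exact Finset.sum_nonneg fun _ _ => visualRho_nonneg _ _ _ _

/-- For small `ε` the function `ρ_{w,ε}` is a quasi-ultrametric with constant at most `2`, so
Frink's lemma makes it comparable to the visual metric. -/
theorem FourPoint.visualRho_le_visualDist {h : ℝ} (H : FourPoint h X) (w : X) {ε : ℝ}
    (hε : 0 < ε) (hh : 0 ≤ h) (hεh : ε * h ≤ Real.log 2) (ξ ζ : Boundary X) :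
    visualRho w ε ξ ζ ≤ 4 * visualDist w ε ξ ζ := by
  rw [← div_le_iff₀' (by norm_num)]
  refine le_csInf ⟨_, 1, fun n => if n = 0 then ξ else ζ, le_rfl, by simp, by simp, rfl⟩ ?_
  rintro _ ⟨n, c, hn, rfl, rfl, rfl⟩
  rw [div_le_iff₀' (by norm_num)]
  refine frink (visualRho_nonneg w ε) (Real.one_le_exp (by positivity)) ?_
    (H.visualRho_le_mul_max w hε) c hn
  rw [← Real.exp_log (by norm_num : (0 : ℝ) < 2)]
  exact Real.exp_le_exp.2 hεh

/-! ### Branching of rays -/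

/-- Uniform perfectness in terms of rays: from each ray another one branches off within time `N`
after any given time. -/
def RaysBranch (w : X) (N : ℝ) : Prop :=
  ∀ σ : ℝ → X, IsRay σ w → ∀ s, 0 ≤ s → ∃ η : ℝ → X, IsRay η w ∧
    (∀ t, 0 ≤ t → gromovProd w (σ t) (η t) ≤ s + N) ∧ ∃ t, 0 ≤ t ∧ s ≤ gromovProd w (σ t) (η t)

theorem FourPoint.exists_raysBranch [ProperSpace X] {h : ℝ} (H : FourPoint h X) (hh : 0 ≤ h)
    (hgeo : IsGeodesicSpace X) {w : X} {ε : ℝ} (hε : 0 < ε) (hεh : ε * h ≤ Real.log 2)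
    (hup : IsUniformlyPerfect (visualDist (X := X) w ε)) : ∃ N, 0 ≤ N ∧ RaysBranch w N := by
  obtain ⟨S, hS, r₀, hr₀, hup⟩ := hup
  have hS0 : 0 < S := by linarith
  have hlogS : 0 ≤ Real.log S := Real.log_nonneg hS
  have hlog5 : 0 ≤ Real.log 5 := Real.log_nonneg (by norm_num)
  -- `e ^ (-ε (s + a)) ≤ r₀` for all `s ≥ 0`, and the factor `5` beats the `4` of Frink's lemma
  set a := |Real.log r₀| / ε + Real.log 5 / ε with ha
  have ha0 : 0 ≤ a := by positivity
  refine ⟨a + Real.log S / ε + 2 * h, by positivity, fun σ hσ s hs => ?_⟩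
  set ξ : Boundary X := Quot.mk _ ⟨_, hσ.isGromovSeq⟩
  have hξ : Represents (fun n : ℕ => σ n) ξ := ⟨hσ.isGromovSeq, rfl⟩
  have hea : ε * a = |Real.log r₀| + Real.log 5 := by rw [ha]; field_simp
  have hr : Real.exp (-ε * (s + a)) ≤ r₀ := by
    rw [← Real.le_log_iff_exp_le hr₀]
    have h1 := neg_abs_le (Real.log r₀)
    have : 0 ≤ ε * s := by positivity
    linarith
  obtain ⟨ζ, h1, h2⟩ := hup ξ _ (Real.exp_pos _) hr
  obtain ⟨η, hη, hηζ⟩ := H.exists_isRay_represents hgeo w ζ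
  refine ⟨η, hη, fun t ht => ?_, ?_⟩
  · by_contra! hcon
    have h3 := (visualRho_le_exp_iff w hε ξ ζ _).2
      (H.le_bdryProd_of_rays hσ hη hξ hηζ ht hh hcon.le)
    have h4 := visualDist_le_visualRho w ε ξ ζ
    have h5 : Real.exp (-ε * (s + a)) / S =
        Real.exp (-ε * (s + (a + Real.log S / ε + 2 * h) - 2 * h)) := by
      nth_rw 1 [← Real.exp_log hS0]
      rw [← Real.exp_sub]
      congr 1
      field_simp
      ring
    linarith
  · by_contra! hcon
    have h3 := mt (visualRho_lt_exp_iff w hε ξ ζ s).1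
      (not_lt.2 (bdryProd_le_of_rays hξ hηζ fun t ht => (hcon t ht).le))
    have h4 := H.visualRho_le_visualDist w hε hh hεh ξ ζ
    have h5 : Real.exp (-ε * (s + a)) ≤ Real.exp (-ε * s) / 5 := by
      nth_rw 1 [← Real.exp_log (by norm_num : (0 : ℝ) < 5)]
      rw [← Real.exp_sub, Real.exp_le_exp]
      have := abs_nonneg (Real.log r₀)
      linarith
    have h6 := Real.exp_pos (-ε * s)
    linarith

theorem FourPoint.isUniformlyPerfect [ProperSpace X] {h : ℝ} (H : FourPoint h X) (hh : 0 ≤ h)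
    (hgeo : IsGeodesicSpace X) {w : X} {ε : ℝ} (hε : 0 < ε) (hεh : ε * h ≤ Real.log 2)
    {N : ℝ} (hN0 : 0 ≤ N) (hN : RaysBranch w N) :
    IsUniformlyPerfect (visualDist (X := X) w ε) := by
  have hS : 1 ≤ Real.exp (ε * (2 * h + N)) := Real.one_le_exp (by positivity)
  refine ⟨8 * Real.exp (ε * (2 * h + N)), by linarith, 1, one_pos, fun ξ r hr hr1 => ?_⟩
  obtain ⟨s, rfl⟩ : ∃ s, r = Real.exp (-ε * s) :=
    ⟨-Real.log r / ε, by rw [show -ε * (-Real.log r / ε) = Real.log r by field_simp,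
      Real.exp_log hr]⟩
  have hs : 0 ≤ s := by
    rw [Real.exp_le_one_iff] at hr1
    nlinarith
  obtain ⟨σ, hσ, hσξ⟩ := H.exists_isRay_represents hgeo w ξ
  obtain ⟨η, hη, h1, t, ht, h2⟩ := hN σ hσ (s + 2 * h) (by positivity)
  set ζ : Boundary X := Quot.mk _ ⟨_, hη.isGromovSeq⟩
  have hηζ : Represents (fun n : ℕ => η n) ζ := ⟨hη.isGromovSeq, rfl⟩
  refine ⟨ζ, ?_, ?_⟩
  · have h3 := mt (visualRho_lt_exp_iff w hε ξ ζ _).1 (not_lt.2 (bdryProd_le_of_rays hσξ hηζ h1))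
    have h4 := H.visualRho_le_visualDist w hε hh hεh ξ ζ
    have h5 : Real.exp (-ε * s) / (8 * Real.exp (ε * (2 * h + N))) =
        Real.exp (-ε * (s + 2 * h + N)) / 8 := by
      rw [mul_comm 8, ← div_div, ← Real.exp_sub]
      congr 2
      ring
    have h6 := Real.exp_pos (-ε * (s + 2 * h + N))
    rw [h5]
    linarith
  · refine (visualDist_le_visualRho w ε ξ ζ).trans ((visualRho_le_exp_iff w hε ξ ζ s).2 ?_)
    convert H.le_bdryProd_of_rays hσ hη hσξ hηζ ht hh h2 using 2
    ring

/-! ### Stability of quasi-geodesics -/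

/-- `y 0, …, y n` is a discrete quasi-geodesic. -/
def IsQuasiGeodesic (K C : ℝ) (y : ℕ → X) (n : ℕ) : Prop :=
  ∀ i ≤ n, ∀ j ≤ n, dist (y i) (y j) ≤ K * |(i : ℝ) - j| + C ∧
    |(i : ℝ) - j| ≤ K * (dist (y i) (y j) + C)

/-- A path with short steps that avoids a ball around `w` is exponentially long in terms of the
radius and the Gromov product of its ends: bisection costs `h` at each of `k` scales. -/
theorem FourPoint.le_gromovProd_of_chain {h : ℝ} (H : FourPoint h X) {y : ℕ → X}
    {w : X} {c D : ℝ} (hc : 0 ≤ c) (k : ℕ) : ∀ m n : ℕ, m ≤ n → n ≤ m + 2 ^ k →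
    (∀ i, m ≤ i → i < n → dist (y i) (y (i + 1)) ≤ c) →
    (∀ i, m ≤ i → i ≤ n → D ≤ dist (y i) w) → D - c - k * h ≤ gromovProd w (y m) (y n) := by
  induction k with
  | zero =>
    intro m n hmn hn hstep hfar
    have h1 := hfar m le_rfl hmn
    have h2 := gromovProd_le_gromovProd_add_dist_right w (y m) (y m) (y n)
    rw [gromovProd_self] at h2
    obtain rfl | rfl : n = m ∨ n = m + 1 := by omega
    · rw [dist_self] at h2
      simp only [Nat.cast_zero, zero_mul]
      linarith
    · have := hstep m le_rfl (by omega)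
      simp only [Nat.cast_zero, zero_mul]
      linarith
  | succ k ih =>
    intro m n hmn hn hstep hfar
    rw [pow_succ] at hn
    set q := min n (m + 2 ^ k) with hq
    have hmq : m ≤ q := le_min hmn (by omega)
    have hqn : q ≤ n := min_le_left _ _
    have h1 := ih m q hmq (min_le_right _ _) (fun i h1 h2 => hstep i h1 (by omega))
      (fun i h1 h2 => hfar i h1 (by omega))
    have h2 := ih q n hqn (by omega) (fun i h1 h2 => hstep i (by omega) h2)
      (fun i h1 h2 => hfar i (by omega) h2)
    have h3 := H w (y m) (y q) (y n)
    have h4 := le_min h1 h2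
    push_cast
    linarith

theorem eventually_linear_le_two_pow (A B : ℝ) : ∀ᶠ k : ℕ in atTop, A + B * k ≤ 2 ^ k := by
  have h1 : Tendsto (fun k : ℕ => A * (1 / 2 : ℝ) ^ k + B * ((k : ℝ) ^ 1 / 2 ^ k)) atTop
      (𝓝 (A * 0 + B * 0)) :=
    ((tendsto_pow_atTop_nhds_zero_of_lt_one (by norm_num) (by norm_num)).const_mul A).add
      ((tendsto_pow_const_div_const_pow_of_one_lt 1 one_lt_two).const_mul B)
  rw [mul_zero, mul_zero, add_zero] at h1
  filter_upwards [h1.eventually (ge_mem_nhds one_pos)] with k hk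
  have h2 : (0 : ℝ) < 2 ^ k := by positivity
  have h3 : A * (1 / 2 : ℝ) ^ k + B * ((k : ℝ) ^ 1 / 2 ^ k) = (A + B * k) / 2 ^ k := by
    rw [one_div, inv_pow, pow_one]; field_simp
  rwa [h3, div_le_one h2] at hk

/-- Geodesics stay close to quasi-geodesics with the same ends: at the point `w` of the geodesic
where the distance `D` to the quasi-geodesic is maximal, the quasi-geodesic makes a detour around
the `D`-ball whose length is linear in `D`, but has to be exponential in `D`. -/
theorem FourPoint.exists_geodesic_close {h : ℝ} (H : FourPoint h X) (hh : 0 ≤ h) {K C : ℝ}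
    (hK : 0 ≤ K) (hC : 0 ≤ C) : ∃ D₀, 0 ≤ D₀ ∧ ∀ (y : ℕ → X) (n : ℕ), IsQuasiGeodesic K C y n →
      ∀ g : ℝ → X, IsGeodesic g (y 0) (y n) → ∀ t ∈ Set.Icc 0 (dist (y 0) (y n)),
        ∃ i ≤ n, dist (g t) (y i) ≤ D₀ := by
  obtain ⟨k₀, hk₀⟩ := eventually_atTop.1
    (eventually_linear_le_two_pow (K * (6 * (K + C + 3 * h) + C)) (K * (6 * h)))
  refine ⟨K + C + (k₀ + 2) * h, by positivity, fun y n hy g hg t ht => ?_⟩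
  set Y : Set X := y '' Set.Iic n
  have hYc : IsCompact Y := ((Set.finite_Iic n).image y).isCompact
  have hYn : Y.Nonempty := ⟨y 0, 0, Set.mem_Iic.2 (Nat.zero_le n), rfl⟩
  obtain ⟨τ, hτ, hmax⟩ := isCompact_Icc.exists_isMaxOn ⟨t, ht⟩
    ((Metric.continuous_infDist_pt Y).comp_continuousOn hg.continuousOn)
  set w := g τ with hw
  set D := Metric.infDist w Y with hD
  have hD0 : 0 ≤ D := Metric.infDist_nonneg
  have hfar : ∀ i ≤ n, D ≤ dist (y i) w := fun i hi => by
    rw [dist_comm]; exact Metric.infDist_le_dist_of_mem ⟨i, hi, rfl⟩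
  have hnear : ∀ s ∈ Set.Icc 0 (dist (y 0) (y n)), ∃ i ≤ n, dist (g s) (y i) ≤ D := by
    intro s hs
    obtain ⟨_, ⟨i, hi, rfl⟩, hdi⟩ := hYc.exists_infDist_eq_dist hYn (g s)
    exact ⟨i, hi, hdi ▸ hmax hs⟩
  suffices hDle : D ≤ K + C + (k₀ + 2) * h by
    obtain ⟨i, hi, hti⟩ := hnear t ht
    exact ⟨i, hi, hti.trans hDle⟩
  -- go back and forth from `w` by `2 * D`, or to the end, and jump to the quasi-geodesic
  have hprod : ∀ s ∈ Set.Icc 0 (dist (y 0) (y n)), |s - τ| = 2 * D → ∀ i ≤ n,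
      dist (g s) (y i) ≤ D → D ≤ gromovProd w (g s) (y i) := by
    intro s hs hsτ i hi hsi
    have h1 := hfar i hi
    rw [gromovProd, hg.2.2 s hs τ hτ, hsτ]
    linarith
  obtain ⟨s₁, hs₁, hs₁τ, hs₁D, i, hi, hs₁i, hpi⟩ : ∃ s ∈ Set.Icc 0 (dist (y 0) (y n)), s ≤ τ ∧
      τ - s ≤ 2 * D ∧ ∃ i ≤ n, dist (g s) (y i) ≤ D ∧ D ≤ gromovProd w (g s) (y i) := by
    rcases le_total τ (2 * D) with hle | hle
    · refine ⟨0, ⟨le_rfl, dist_nonneg⟩, hτ.1, by linarith, 0, Nat.zero_le n, ?_, ?_⟩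
      · simpa [hg.1] using hD0
      · rw [hg.1, gromovProd_self]; exact hfar 0 (Nat.zero_le n)
    · have hs : τ - 2 * D ∈ Set.Icc 0 (dist (y 0) (y n)) := ⟨by linarith, by linarith [hτ.2]⟩
      obtain ⟨i, hi, hsi⟩ := hnear _ hs
      refine ⟨_, hs, by linarith, by linarith, i, hi, hsi, hprod _ hs ?_ i hi hsi⟩
      rw [abs_of_nonpos (by linarith)]; ring
  obtain ⟨s₂, hs₂, hs₂τ, hs₂D, j, hj, hs₂j, hpj⟩ : ∃ s ∈ Set.Icc 0 (dist (y 0) (y n)), τ ≤ s ∧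
      s - τ ≤ 2 * D ∧ ∃ i ≤ n, dist (g s) (y i) ≤ D ∧ D ≤ gromovProd w (g s) (y i) := by
    rcases le_total (dist (y 0) (y n)) (τ + 2 * D) with hle | hle
    · refine ⟨dist (y 0) (y n), ⟨dist_nonneg, le_rfl⟩, hτ.2, by linarith, n, le_rfl, ?_, ?_⟩
      · simpa [hg.2.1] using hD0
      · rw [hg.2.1, gromovProd_self]; exact hfar n le_rfl
    · have hs : τ + 2 * D ∈ Set.Icc 0 (dist (y 0) (y n)) := ⟨by linarith [hτ.1], by linarith⟩
      obtain ⟨i, hi, hsi⟩ := hnear _ hs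
      refine ⟨_, hs, by linarith, by linarith, i, hi, hsi, hprod _ hs ?_ i hi hsi⟩
      rw [abs_of_nonneg (by linarith)]; ring
  have hzero : gromovProd w (g s₁) (g s₂) = 0 := by
    rw [gromovProd, hg.2.2 _ hs₁ _ hτ, hg.2.2 _ hs₂ _ hτ, hg.2.2 _ hs₁ _ hs₂,
      abs_of_nonpos (by linarith), abs_of_nonneg (by linarith), abs_of_nonpos (by linarith)]
    ring
  have hij : |(i : ℝ) - j| ≤ K * (6 * D + C) := by
    refine (hy i hi j hj).2.trans (mul_le_mul_of_nonneg_left ?_ hK)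
    have h1 := dist_triangle4 (y i) (g s₁) (g s₂) (y j)
    rw [dist_comm (y i) (g s₁), hg.2.2 _ hs₁ _ hs₂, abs_of_nonpos (by linarith)] at h1
    linarith
  have hstep : ∀ l, l < n → dist (y l) (y (l + 1)) ≤ K + C := fun l hl => by
    have := (hy l (by omega) (l + 1) (by omega)).1
    push_cast at this
    rwa [show (l : ℝ) - (l + 1) = -1 by ring, abs_neg, abs_one, mul_one] at this
  have hmain : ∀ k : ℕ, K * (6 * D + C) ≤ 2 ^ k → D ≤ K + C + (k + 2) * h := by
    intro k hk
    have hk' : |(i : ℝ) - j| ≤ 2 ^ k := hij.trans hk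
    have h1 : D - (K + C) - k * h ≤ gromovProd w (y i) (y j) := by
      rcases le_total i j with hle | hle
      · refine H.le_gromovProd_of_chain (by positivity) k i j hle ?_
          (fun l _ h2 => hstep l (by omega)) (fun l _ h2 => hfar l (by omega))
        rw [abs_sub_comm] at hk'
        have := (le_abs_self _).trans hk'
        rw [← @Nat.cast_le ℝ]; push_cast; linarith
      · rw [gromovProd_comm]
        refine H.le_gromovProd_of_chain (by positivity) k j i hle ?_
          (fun l _ h2 => hstep l (by omega)) (fun l _ h2 => hfar l (by omega))
        have := (le_abs_self _).trans hk'
        rw [← @Nat.cast_le ℝ]; push_cast; linarith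
    have h2 := H w (g s₁) (y i) (y j)
    have h3 := H w (g s₁) (y j) (g s₂)
    rw [gromovProd_comm w (g s₂)] at hpj
    have hk0 : 0 ≤ k * h := by positivity
    have h4 : D - (K + C) - k * h ≤ min (gromovProd w (g s₁) (y i)) (gromovProd w (y i) (y j)) :=
      le_min (by linarith) h1
    have h5 : D - (K + C) - k * h - h ≤
        min (gromovProd w (g s₁) (y j)) (gromovProd w (y j) (g s₂)) :=
      le_min (by linarith) (by linarith)
    linarith
  by_contra! hcon
  -- the first `k > k₀` with `K * (6 * D + C) ≤ 2 ^ k` contradicts the choice of `k₀`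
  have hex : ∃ k : ℕ, K * (6 * D + C) ≤ 2 ^ k := by
    obtain ⟨k, hk⟩ := (eventually_linear_le_two_pow (K * (6 * D + C)) 0).exists
    exact ⟨k, by linarith⟩
  classical
  have hspec := Nat.find_spec hex
  have hmin := fun {m} => Nat.find_min hex (m := m)
  set k := Nat.find hex
  have hklt : k₀ < k := by
    by_contra! hle
    have h1 := hmain k hspec
    have h2 : (k : ℝ) ≤ k₀ := by exact_mod_cast hle
    have h3 : (k + 2) * h ≤ (k₀ + 2) * h := by gcongr
    linarith
  obtain ⟨l, hl⟩ : ∃ l, k = l + 1 := ⟨k - 1, by omega⟩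
  have h1 := hmin (m := l) (by omega)
  have h2 := hmain k hspec
  have h3 := hk₀ l (by omega)
  rw [hl] at h2
  push_cast at h2
  have h4 : K * (6 * D + C) ≤ K * (6 * (K + C + (l + 1 + 2) * h) + C) := by gcongr
  exact h1 (h4.trans (le_trans (le_of_eq (by ring)) h3))

/-- Quasi-geodesics stay close to geodesics with the same ends. By connectedness the geodesic has
a point that is close both to the part of the quasi-geodesic before `y m` and to the part after
it; these parts are then close to each other, and so is `y m`, which lies between them. -/
theorem FourPoint.exists_quasiGeodesic_close {h : ℝ} (H : FourPoint h X) (hh : 0 ≤ h)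
    (hgeo : IsGeodesicSpace X) {K C : ℝ} (hK : 0 ≤ K) (hC : 0 ≤ C) :
    ∃ M, 0 ≤ M ∧ ∀ (y : ℕ → X) (n : ℕ), IsQuasiGeodesic K C y n →
      ∀ m ≤ n, gromovProd (y m) (y 0) (y n) ≤ M := by
  obtain ⟨D, hD, hclose⟩ := H.exists_geodesic_close hh hK hC
  refine ⟨D + (K * (K * (2 * D + C)) + C), by positivity, fun y n hy m hm => ?_⟩
  obtain ⟨g, hg⟩ := hgeo.exists_isGeodesic (y 0) (y n)
  set P := g '' Set.Icc 0 (dist (y 0) (y n))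
  have hP : IsPreconnected P := isPreconnected_Icc.image _ hg.continuousOn
  have h0P : y 0 ∈ P := ⟨0, ⟨le_rfl, dist_nonneg⟩, hg.1⟩
  have hnP : y n ∈ P := ⟨dist (y 0) (y n), ⟨dist_nonneg, le_rfl⟩, hg.2.1⟩
  obtain ⟨p, ⟨t, ht, rfl⟩, hp1, hp2⟩ := isPreconnected_closed_iff.1 hP
    (⋃ i ∈ Set.Icc 0 m, Metric.closedBall (y i) D) (⋃ i ∈ Set.Icc m n, Metric.closedBall (y i) D)
    ((Set.finite_Icc 0 m).isClosed_biUnion fun _ _ => Metric.isClosed_closedBall)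
    ((Set.finite_Icc m n).isClosed_biUnion fun _ _ => Metric.isClosed_closedBall)
    (by
      rintro _ ⟨t, ht, rfl⟩
      obtain ⟨i, hi, hti⟩ := hclose y n hy g hg t ht
      rcases le_total i m with h | h
      · exact Or.inl (Set.mem_biUnion (x := i) ⟨Nat.zero_le i, h⟩ hti)
      · exact Or.inr (Set.mem_biUnion (x := i) ⟨h, hi⟩ hti))
    ⟨y 0, h0P, Set.mem_biUnion (x := 0) ⟨le_rfl, Nat.zero_le m⟩ (Metric.mem_closedBall_self hD)⟩
    ⟨y n, hnP, Set.mem_biUnion (x := n) ⟨hm, le_rfl⟩ (Metric.mem_closedBall_self hD)⟩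
  obtain ⟨i, ⟨-, him⟩, hi⟩ := Set.mem_iUnion₂.1 hp1
  obtain ⟨j, ⟨hmj, hjn⟩, hj⟩ := Set.mem_iUnion₂.1 hp2
  rw [Metric.mem_closedBall] at hi hj
  have h1 := (hy i (him.trans hm) j hjn).2
  have h2 := (hy i (him.trans hm) m hm).1
  have h3 : |(i : ℝ) - m| ≤ |(i : ℝ) - j| := by
    have h4 : (i : ℝ) ≤ m := by exact_mod_cast him
    have h5 : (m : ℝ) ≤ j := by exact_mod_cast hmj
    rw [abs_of_nonpos (by linarith), abs_of_nonpos (by linarith)]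
    linarith
  have h4 := dist_triangle_left (y i) (y j) (g t)
  have h5 : K * |(i : ℝ) - m| ≤ K * (K * (2 * D + C)) := by
    refine mul_le_mul_of_nonneg_left (h3.trans (h1.trans ?_)) hK
    gcongr
    linarith
  have h6 := dist_triangle (g t) (y i) (y m)
  have h7 := gromovProd_le_dist_of_between (w := y m) (hg.between ht)
  linarith

/-- Quasi-isometries preserve betweenness up to bounded error. -/
theorem FourPoint.exists_gromovProd_map_le {δ h : ℝ} (hδ : 0 ≤ δ) (hhyp : IsHyperbolic δ X)
    (H : FourPoint h X) (hh : 0 ≤ h) (hgeo : IsGeodesicSpace X) {f : X → X}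
    (hf : IsQuasiIsometry f) (c : ℝ) : ∃ M, ∀ a b x : X, gromovProd x a b ≤ c →
      gromovProd (f x) (f a) (f b) ≤ M := by
  obtain ⟨K, C, hK, hC, hf, -⟩ := hf
  have hK0 : 0 < K := by linarith
  have hlow : ∀ x y, dist x y ≤ K * (dist (f x) (f y) + C) := fun x y => by
    have h1 := (hf x y).1
    have h2 : K⁻¹ * dist x y ≤ dist (f x) (f y) + C := by linarith
    rwa [inv_mul_le_iff₀ hK0] at h2
  obtain ⟨M, hM, hclose⟩ := H.exists_quasiGeodesic_close hh hgeo hK0.le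
    (show 0 ≤ C + 1 by linarith)
  refine ⟨M + (K * (c + 2 * δ + 1) + C), fun a b x hx => ?_⟩
  obtain ⟨g, hg⟩ := hgeo.exists_isGeodesic a b
  obtain ⟨t, ht, htx⟩ := hhyp.exists_dist_le_gromovProd hδ hgeo x hg
  set l := dist a b with hl
  have hmem : ∀ i : ℕ, min (i : ℝ) l ∈ Set.Icc 0 l := fun i =>
    ⟨le_min (Nat.cast_nonneg i) dist_nonneg, min_le_right _ _⟩
  -- the integer times, and the end of the geodesic, which is at time `l`
  have hqg : IsQuasiGeodesic K (C + 1) (fun i : ℕ => f (g (min (i : ℝ) l))) ⌈l⌉₊ := by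
    intro i hi j hj
    have h1 := hg.2.2 _ (hmem i) _ (hmem j)
    have h2 : ∀ i : ℕ, i ≤ ⌈l⌉₊ → (i : ℝ) - 1 ≤ min (i : ℝ) l := fun i hi => by
      have h3 : (i : ℝ) ≤ ⌈l⌉₊ := by exact_mod_cast hi
      have h4 := Nat.ceil_lt_add_one (show 0 ≤ l from dist_nonneg)
      exact le_min (by linarith) (by linarith)
    have h3 : |min (i : ℝ) l - min (j : ℝ) l| ≤ |(i : ℝ) - j| := by
      simpa using abs_min_sub_min_le_max (i : ℝ) l j l
    have h4 : |(i : ℝ) - j| ≤ |min (i : ℝ) l - min (j : ℝ) l| + 1 := by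
      have h5 := h2 i hi
      have h6 := h2 j hj
      have h7 := min_le_left (i : ℝ) l
      have h8 := min_le_left (j : ℝ) l
      have h9 := abs_le.1 (le_refl |min (i : ℝ) l - min (j : ℝ) l|)
      exact abs_le.2 ⟨by linarith, by linarith⟩
    rw [← h1] at h3 h4
    constructor
    · refine (hf _ _).2.trans ?_
      have := mul_le_mul_of_nonneg_left h3 hK0.le
      linarith
    · have := hlow (g (min (i : ℝ) l)) (g (min (j : ℝ) l))
      linarith
  have hfl : ⌊t⌋₊ ≤ ⌈l⌉₊ := (Nat.floor_le_ceil t).trans (Nat.ceil_mono ht.2)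
  have h1 := hclose _ _ hqg ⌊t⌋₊ hfl
  have hend : min (⌈l⌉₊ : ℝ) l = l := min_eq_right (Nat.le_ceil l)
  have hfloor : min (⌊t⌋₊ : ℝ) l = ⌊t⌋₊ := min_eq_left ((Nat.floor_le ht.1).trans ht.2)
  have h0 : min ((0 : ℕ) : ℝ) l = 0 := by rw [Nat.cast_zero]; exact min_eq_left dist_nonneg
  have hgl : g l = b := hg.2.1
  simp only [hend, hfloor, h0, hg.1, hgl] at h1
  have h2 := gromovProd_le_gromovProd_add_dist_base (f x) (f (g ⌊t⌋₊)) (f a) (f b)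
  have h3 : dist x (g ⌊t⌋₊) ≤ c + 2 * δ + 1 := by
    have h4 := hg.2.2 _ ht _ (hfloor ▸ hmem ⌊t⌋₊)
    have h5 : |t - ⌊t⌋₊| ≤ 1 := by
      have h6 := Nat.floor_le ht.1
      have h7 := Nat.lt_floor_add_one t
      exact abs_le.2 ⟨by linarith, by linarith⟩
    have h6 := dist_triangle_left x (g ⌊t⌋₊) (g t)
    linarith
  have h4 := (hf x (g ⌊t⌋₊)).2
  have h5 := mul_le_mul_of_nonneg_left h3 hK0.le
  linarith

/-! ### Centers of ideal triangles -/

theorem gromovProd_change_base (w x a b : X) :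
    gromovProd x a b = dist x w + gromovProd w a b - gromovProd w a x - gromovProd w b x := by
  simp only [gromovProd]; ring

/-- Every point is a coarse center of an ideal triangle, whose vertices are given by
rays from `w`: the Gromov products at the point, taken far out along the rays, are at most `C`. -/
def HasTripods (w : X) (C : ℝ) : Prop :=
  ∀ x : X, ∃ a b c : ℝ → X, IsRay a w ∧ IsRay b w ∧ IsRay c w ∧
    ∀ᶠ n : ℕ in atTop, gromovProd x (a n) (b n) ≤ C ∧ gromovProd x (b n) (c n) ≤ C ∧
      gromovProd x (a n) (c n) ≤ C

/-- If rays branch, then a point on a ray `σ` is a center of the ideal triangle spanned by `σ`, a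
ray that leaves `σ` near that point, and a ray that leaves `σ` near the origin. -/
theorem FourPoint.hasTripods {h : ℝ} (H : FourPoint h X) (hh : 0 ≤ h) {w : X} {L N : ℝ}
    (hL : 0 ≤ L) (hpole : IsRayPole L w) (hN0 : 0 ≤ N) (hN : RaysBranch w N) :
    HasTripods w (3 * N + 2 * L + 4 * h + 2) := by
  intro x
  obtain ⟨σ, hσ, hσx⟩ := hpole x
  -- moving out along `σ` makes the point further from `w` than the branching of the third ray
  set τ := dist x w + (N + h + 1) with hτ
  have hx0 : 0 ≤ dist x w := dist_nonneg
  have hτ0 : 0 ≤ τ := by positivity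
  have hxτ : dist x (σ τ) ≤ L + (N + h + 1) := by
    have h1 := hσ.2 _ (Set.mem_Ici.2 hx0) τ (Set.mem_Ici.2 hτ0)
    rw [abs_of_nonpos (by linarith)] at h1
    have h2 := dist_triangle x (σ (dist x w)) (σ τ)
    linarith
  obtain ⟨η, hη, hη1, t, ht, hη2⟩ := hN σ hσ τ hτ0
  obtain ⟨ζ, hζ, hζ1, -⟩ := hN σ hσ 0 le_rfl
  refine ⟨σ, η, ζ, hσ, hη, hζ, ?_⟩
  obtain ⟨m, hm⟩ := exists_nat_ge (max τ t)
  filter_upwards [eventually_ge_atTop m] with n hn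
  have hn0 : (0 : ℝ) ≤ n := Nat.cast_nonneg n
  have hmn : max τ t ≤ (n : ℝ) := hm.trans (by exact_mod_cast hn)
  have hnτ : τ ≤ n := (le_max_left _ _).trans hmn
  have hnt : t ≤ n := (le_max_right _ _).trans hmn
  have h1 := hη1 n hn0
  have h2 := hζ1 n hn0
  have h3 := hη2.trans (hσ.gromovProd_mono hη ht ht hnt hnt)
  have h4 : τ - (L + (N + h + 1)) ≤ gromovProd w (σ n) x := by
    have h5 := gromovProd_le_gromovProd_add_dist_right w (σ n) (σ τ) x
    rw [hσ.gromovProd_eq hn0 hτ0, min_eq_right hnτ, dist_comm] at h5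
    linarith
  have h5 : τ - (L + (N + h + 1)) - h ≤ gromovProd w (η n) x := by
    refine H.le ?_ h4
    rw [gromovProd_comm]
    linarith
  have h6 : gromovProd w (η n) (ζ n) ≤ N + h := by
    by_contra! hcon
    have := H.lt (show N + h < gromovProd w (σ n) (η n) by linarith) hcon
    linarith
  have h7 := gromovProd_nonneg w (ζ n) x
  have e1 := gromovProd_change_base w x (σ n) (η n)
  have e2 := gromovProd_change_base w x (η n) (ζ n)
  have e3 := gromovProd_change_base w x (σ n) (ζ n)
  exact ⟨by linarith, by linarith, by linarith⟩

/-- As seen from `x`, a point `q` can lie in the direction of at most one vertex of a triangle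
with center `x`. -/
theorem FourPoint.two_of_three {h : ℝ} (H : FourPoint h X) {x a b c : X} {C : ℝ}
    (hab : gromovProd x a b ≤ C) (hbc : gromovProd x b c ≤ C) (hac : gromovProd x a c ≤ C)
    (q : X) : (gromovProd x a q ≤ C + h ∧ gromovProd x b q ≤ C + h) ∨
      (gromovProd x b q ≤ C + h ∧ gromovProd x c q ≤ C + h) ∨
      (gromovProd x a q ≤ C + h ∧ gromovProd x c q ≤ C + h) := by
  have key : ∀ u v, gromovProd x u v ≤ C → gromovProd x u q ≤ C + h ∨ gromovProd x v q ≤ C + h := by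
    intro u v huv
    have h1 := H x u q v
    rw [gromovProd_comm x q v] at h1
    exact min_le_iff.1 (by linarith)
  have h1 := key a b hab
  have h2 := key b c hbc
  have h3 := key a c hac
  tauto

theorem FourPoint.dist_centers_le {h : ℝ} (H : FourPoint h X) {x y a b c : X} {C : ℝ}
    (hab : gromovProd x a b ≤ C) (hbc : gromovProd x b c ≤ C) (hac : gromovProd x a c ≤ C)
    (hab' : gromovProd y a b ≤ C) (hbc' : gromovProd y b c ≤ C) (hac' : gromovProd y a c ≤ C) :
    dist x y ≤ 2 * (C + h) := by
  have key : ∀ u, gromovProd x u y ≤ C + h → gromovProd y u x ≤ C + h →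
      dist x y ≤ 2 * (C + h) := by
    intro u h1 h2
    have := gromovProd_add_gromovProd x y u
    linarith
  rcases H.two_of_three hab hbc hac y with ⟨h1, h2⟩ | ⟨h1, h2⟩ | ⟨h1, h2⟩ <;>
  rcases H.two_of_three hab' hbc' hac' x with ⟨h3, h4⟩ | ⟨h3, h4⟩ | ⟨h3, h4⟩ <;>
  first
  | exact key _ h1 h3
  | exact key _ h1 h4
  | exact key _ h2 h3
  | exact key _ h2 h4

/-- A quasi-isometry that fixes the boundary maps a center of an ideal triangle to a center of the
same triangle, and centers are coarsely unique. -/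
theorem HasTripods.isBoundaryRigid {δ h : ℝ} (hδ : 0 ≤ δ) (hhyp : IsHyperbolic δ X)
    (H : FourPoint h X) (hh : 0 ≤ h) (hgeo : IsGeodesicSpace X) {w : X} {C : ℝ}
    (hC : HasTripods w C) : IsBoundaryRigid X := by
  intro f hf hfid
  obtain ⟨M, hM⟩ := H.exists_gromovProd_map_le hδ hhyp hh hgeo hf C
  set B := max C (M + 2 * h)
  refine ⟨2 * (B + h), ?_⟩
  rintro _ ⟨x, rfl⟩
  obtain ⟨a, b, c, ha, hb, hc, hev⟩ := hC x
  have hfix : ∀ u : ℝ → X, IsRay u w →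
      Tendsto (fun n : ℕ => gromovProd (f x) (f (u n)) (u n)) atTop atTop := by
    intro u hu
    have h1 : Represents (fun n : ℕ => u n) (Quot.mk _ ⟨_, hu.isGromovSeq⟩) := ⟨_, rfl⟩
    exact H.tendsto_of_represents (hfid _ _ h1) h1 (f x)
  obtain ⟨n, ⟨h1, h2, h3⟩, h4, h5, h6⟩ := (hev.and
    ((tendsto_atTop.1 (hfix a ha) (B + 1)).and ((tendsto_atTop.1 (hfix b hb) (B + 1)).and
      (tendsto_atTop.1 (hfix c hc) (B + 1))))).exists
  have key : ∀ u v : X, gromovProd x u v ≤ C → B + 1 ≤ gromovProd (f x) (f u) u →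
      B + 1 ≤ gromovProd (f x) (f v) v → gromovProd (f x) u v ≤ B := by
    intro u v huv hu hv
    have hB : M + 2 * h ≤ B := le_max_right _ _
    by_contra! hcon
    rw [gromovProd_comm] at hv
    have h7 := H.lt (show B - h < gromovProd (f x) (f u) u by linarith)
      (H.lt hcon (show B < gromovProd (f x) v (f v) by linarith))
    have h8 := hM u v x huv
    linarith
  exact H.dist_centers_le (h1.trans (le_max_left _ _)) (h2.trans (le_max_left _ _))
    (h3.trans (le_max_left _ _)) (key _ _ h1 h4 h5) (key _ _ h2 h5 h6) (key _ _ h3 h4 h6)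

/-! ### Geodesic richness -/

/-- Through a center `p` of an ideal triangle passes a side of the triangle that leaves `p` in
directions different from that of `q`. -/
theorem HasTripods.exists_isLine [ProperSpace X] {δ h : ℝ} (hδ : 0 ≤ δ) (hhyp : IsHyperbolic δ X)
    (H : FourPoint h X) (hgeo : IsGeodesicSpace X) {w : X} {C : ℝ}
    (hC : HasTripods w C) (p q : X) : ∃ γ : ℝ → X, IsLine γ ∧ dist (γ 0) p ≤ C + 2 * δ ∧
      ∀ t, gromovProd p (γ t) q ≤ C + 2 * h + 1 := by
  have key : ∀ a b : ℝ → X, IsRay a w → IsRay b w → (∃ᶠ n : ℕ in atTop,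
      gromovProd p (a n) (b n) ≤ C ∧ gromovProd p (a n) q ≤ C + h ∧
        gromovProd p (b n) q ≤ C + h) → ∃ γ : ℝ → X, IsLine γ ∧ dist (γ 0) p ≤ C + 2 * δ ∧
      ∀ t, gromovProd p (γ t) q ≤ C + 2 * h + 1 := by
    intro a b ha hb hev
    obtain ⟨φ, hφ, hφ'⟩ := extraction_of_frequently_atTop hev
    obtain ⟨γ, hγ, hγp, hγt⟩ := exists_isLine_of_gromovProd_le hδ hhyp hgeo
      ((ha.isGromovSeq.tendsto_dist p).comp hφ.tendsto_atTop)
      ((hb.isGromovSeq.tendsto_dist p).comp hφ.tendsto_atTop) fun n => (hφ' n).1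
    refine ⟨γ, hγ, hγp, fun t => ?_⟩
    obtain ⟨n, y, hy, hyt⟩ := hγt t
    obtain ⟨-, h1, h2⟩ := hφ' n
    set A := a (φ n)
    set B := b (φ n)
    have h3 := gromovProd_le_gromovProd_add_dist_left p (γ t) y q
    rw [dist_comm (γ t) y] at h3
    have hz : gromovProd y A B = 0 := by
      rw [gromovProd, dist_comm B y]; linarith
    have h4 := H y A p B
    rw [hz, sub_nonpos, min_le_iff] at h4
    have h5 : ∀ u, gromovProd y u p ≤ h → gromovProd p y q ≤ gromovProd p u q + h := by
      intro u hu
      have h6 := dist_triangle u y q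
      simp only [gromovProd, dist_comm p y] at hu ⊢
      linarith
    rcases h4 with h4 | h4
    · have := h5 A h4; linarith
    · rw [gromovProd_comm] at h4
      have := h5 B h4; linarith
  obtain ⟨a, b, c, ha, hb, hc, hev⟩ := hC p
  have hev' := hev.mono fun n hn => show
      ((gromovProd p (a n) (b n) ≤ C ∧ gromovProd p (a n) q ≤ C + h ∧
        gromovProd p (b n) q ≤ C + h) ∨ (gromovProd p (b n) (c n) ≤ C ∧
        gromovProd p (b n) q ≤ C + h ∧ gromovProd p (c n) q ≤ C + h)) ∨
      (gromovProd p (a n) (c n) ≤ C ∧ gromovProd p (a n) q ≤ C + h ∧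
        gromovProd p (c n) q ≤ C + h) by
    have := H.two_of_three hn.1 hn.2.1 hn.2.2 q
    tauto
  rcases frequently_or_distrib.1 hev'.frequently with h1 | h1
  · rcases frequently_or_distrib.1 h1 with h1 | h1
    · exact key a b ha hb h1
    · exact key b c hb hc h1
  · exact key a c ha hc h1

/-- The part of a line between two of its points passes `w` at a distance that is bounded by the
Gromov product of these points. -/
theorem FourPoint.exists_dist_le_of_isLine {h : ℝ} (H : FourPoint h X) {γ : ℝ → X} (hγ : IsLine γ)
    (w : X) (s t : ℝ) : ∃ u, dist (γ u) w ≤ gromovProd w (γ s) (γ t) + 2 * h := by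
  set r := gromovProd (γ s) (γ t) w with hr
  have hr0 : 0 ≤ r := gromovProd_nonneg _ _ _
  have hrt : r ≤ |t - s| := by
    have := gromovProd_le_left (γ s) (γ t) w
    rwa [hγ.dist_eq, Real.dist_eq] at this
  -- the point `γ u` at distance `r` from `γ s` in the direction of `γ t`
  obtain ⟨u, hu1, hu2⟩ : ∃ u, |u - s| = r ∧ |u - t| = |t - s| - r := by
    rcases le_total s t with hst | hst
    · rw [abs_of_nonneg (by linarith)] at hrt ⊢
      exact ⟨s + r, by simpa using hr0, by rw [abs_of_nonpos (by linarith)]; ring⟩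
    · rw [abs_of_nonpos (by linarith)] at hrt ⊢
      exact ⟨s - r, by simpa using hr0, by rw [abs_of_nonneg (by linarith)]; ring⟩
  have h1 : gromovProd (γ s) (γ u) (γ t) = r := by
    rw [gromovProd, hγ.dist_eq, hγ.dist_eq, hγ.dist_eq, Real.dist_eq, Real.dist_eq, Real.dist_eq,
      hu1, hu2]
    ring
  have h2 := H.le h1.ge hr.le
  rw [gromovProd, hγ.dist_eq, Real.dist_eq, hu1, dist_comm w (γ s)] at h2
  have h3 := gromovProd_add_gromovProd (γ s) w (γ t)
  rw [gromovProd_comm w (γ t)] at h3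
  exact ⟨u, by linarith⟩

theorem FourPoint.gromovProd_le_of_nearest {h : ℝ} (H : FourPoint h X) {γ : ℝ → X} (hγ : IsLine γ)
    {p : X} {s : ℝ} (hs : ∀ t, dist p (γ s) ≤ dist p (γ t)) (t : ℝ) :
    gromovProd (γ s) (γ t) p ≤ 2 * h := by
  obtain ⟨u, hu⟩ := H.exists_dist_le_of_isLine hγ p s t
  have h1 := gromovProd_add_gromovProd (γ s) p (γ t)
  rw [gromovProd_comm p (γ t)] at h1
  have h2 := hs u
  rw [dist_comm p (γ u), dist_comm p (γ s)] at h2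
  linarith

theorem HasTripods.isGeodesicallyRich [ProperSpace X] {δ h : ℝ} (hδ : 0 ≤ δ)
    (hhyp : IsHyperbolic δ X) (H : FourPoint h X) (hh : 0 ≤ h) (hgeo : IsGeodesicSpace X) {w : X}
    {C : ℝ} (hC0 : 0 ≤ C) (hC : HasTripods w C) : IsGeodesicallyRich X := by
  refine ⟨0, C + 2 * δ + 1, 2 * C + 4 * h + 2 * δ + 3, C + 2 * δ + 1, C + 8 * h + 2 * δ + 3,
    fun p q _ => ?_, fun γ hγ p => ?_⟩
  · obtain ⟨γ, hγ, hγp, hγq⟩ := hC.exists_isLine hδ hhyp H hgeo p q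
    rw [dist_comm] at hγp
    have h0 : γ 0 ∈ Set.range γ := ⟨0, rfl⟩
    refine ⟨γ, hγ, (Metric.infDist_le_dist_of_mem h0).trans_lt (by linarith), ?_⟩
    have h1 := Metric.infDist_le_dist_of_mem h0 (x := q)
    have h2 := dist_triangle_left q (γ 0) p
    have h3 : dist p q - 2 * (C + 2 * h + 1) ≤ Metric.infDist q (Set.range γ) := by
      refine (Metric.le_infDist ⟨_, h0⟩).2 ?_
      rintro _ ⟨t, rfl⟩
      have h4 := hγq t
      rw [gromovProd, dist_comm q p, dist_comm (γ t) q] at h4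
      have h5 := dist_nonneg (x := γ t) (y := p)
      linarith
    exact abs_lt.2 ⟨by linarith, by linarith⟩
  · obtain ⟨_, ⟨s, rfl⟩, hs⟩ :=
      (Isometry.isClosedEmbedding hγ).isClosed_range.exists_infDist_eq_dist
      ⟨γ 0, 0, rfl⟩ p
    have hs' : ∀ t, dist p (γ s) ≤ dist p (γ t) := fun t =>
      hs ▸ Metric.infDist_le_dist_of_mem (Set.mem_range_self t)
    obtain ⟨γ', hγ', hγp, hγq⟩ := hC.exists_isLine hδ hhyp H hgeo p (γ s)
    rw [dist_comm] at hγp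
    refine ⟨γ', hγ',
      (Metric.infDist_le_dist_of_mem (Set.mem_range_self 0)).trans_lt (by linarith), ?_⟩
    have h1 : setDist (Set.range γ') (Set.range γ) ≤ dist p (γ s) + (C + 2 * δ) := by
      refine (csInf_le ⟨0, ?_⟩ (Set.mem_image2_of_mem (Set.mem_range_self 0)
        (Set.mem_range_self s))).trans
        ((dist_triangle_left (γ' 0) (γ s) p).trans (by linarith))
      rintro _ ⟨a, -, b, -, rfl⟩
      exact dist_nonneg
    have h2 : dist p (γ s) - (C + 8 * h + 1) ≤ setDist (Set.range γ') (Set.range γ) := by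
      refine le_csInf ⟨_, Set.mem_image2_of_mem (Set.mem_range_self 0) (Set.mem_range_self s)⟩ ?_
      rintro _ ⟨_, ⟨t', rfl⟩, _, ⟨t, rfl⟩, rfl⟩
      -- seen from the foot `γ s` of the perpendicular, `γ t` is not in the direction of `p`,
      -- whereas `γ' t'` is
      have h3 := H.gromovProd_le_of_nearest hγ hs' t
      have h4 := gromovProd_add_gromovProd p (γ s) (γ' t')
      have h5 := hγq t'
      have h6 := H (γ s) (γ t) (γ' t') p
      rcases min_le_iff.1 (show min _ _ ≤ 3 * h by linarith) with h7 | h7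
      · have h8 := gromovProd_le_left (γ s) (γ' t') p
        rw [gromovProd, dist_comm (γ t) (γ' t')] at h7
        have h9 := dist_nonneg (x := γ t) (y := γ s)
        linarith
      · have h8 := dist_nonneg (x := γ' t') (y := γ t)
        linarith
    rw [hs]
    exact abs_lt.2 ⟨by linarith, by linarith⟩

theorem IsLine.isGromovSeq {γ : ℝ → X} (hγ : IsLine γ) : IsGromovSeq (fun n : ℕ => γ n) := by
  have hray : IsRay γ (γ 0) := ⟨rfl, fun s _ t _ => by rw [hγ.dist_eq, Real.dist_eq]⟩
  exact hray.isGromovSeq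

theorem IsLine.reverse {γ : ℝ → X} (hγ : IsLine γ) : IsLine (fun t => γ (-t)) :=
  hγ.comp (IsometryEquiv.neg ℝ).isometry

/-- A line that passes near the point `σ s` but not closer to `w` than that point has two ends
that both follow `σ` up to time `s`; one of them has to leave `σ` there. -/
theorem IsGeodesicallyRich.exists_raysBranch [ProperSpace X] {h : ℝ} (H : FourPoint h X)
    (hh : 0 ≤ h) (hgeo : IsGeodesicSpace X) (w : X) (hrich : IsGeodesicallyRich X) :
    ∃ N, 0 ≤ N ∧ RaysBranch w N := by
  obtain ⟨r₀, r₁, r₂, -, -, hrich, -⟩ := hrich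
  set a := |r₀| + |r₁| + |r₂| + 4 * h with ha
  have ha0 : 0 ≤ a := by positivity
  refine ⟨a + |r₁| + 3 * h, by positivity, fun σ hσ s hs => ?_⟩
  have hs' : 0 ≤ s + a := by positivity
  have hr₀ := le_abs_self r₀
  have hr₁ := le_abs_self r₁
  have hr₂ := le_abs_self r₂
  have := abs_nonneg r₀
  have := abs_nonneg r₁
  have := abs_nonneg r₂
  obtain ⟨γ, hγ, hγp, hγq⟩ := hrich (σ (s + a)) w (by rw [hσ.dist_eq hs']; linarith)
  obtain ⟨_, ⟨t₀, rfl⟩, ht₀⟩ := (Metric.infDist_lt_iff (Set.range_nonempty γ)).1 hγp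
  rw [hσ.dist_eq hs'] at hγq
  have hfar : ∀ t, s + a - r₂ ≤ dist (γ t) w := fun t => by
    have h1 := Metric.infDist_le_dist_of_mem (x := w) (Set.mem_range_self (f := γ) t)
    rw [dist_comm] at h1
    have h2 := (abs_lt.1 hγq).1
    linarith
  have hγσ : ∀ t, ∀ m : ℕ, s + a ≤ m → s + h ≤ gromovProd w (γ t) (σ m) := by
    intro t m hm
    obtain ⟨u, hu⟩ := H.exists_dist_le_of_isLine hγ w t t₀
    have h1 := hfar u
    have h2 := gromovProd_le_gromovProd_add_dist_right w (γ t) (γ t₀) (σ (s + a))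
    rw [dist_comm] at h2
    have h3 := hσ.gromovProd_eq hs' (Nat.cast_nonneg m)
    rw [min_eq_left hm] at h3
    have h4 := H.le (show s + 2 * h ≤ gromovProd w (γ t) (σ (s + a)) by linarith)
      (show s + 2 * h ≤ gromovProd w (σ (s + a)) (σ m) by linarith)
    linarith
  obtain ⟨m₀, hm₀⟩ := exists_nat_ge (s + a)
  -- both ends of `γ` follow `σ` at least up to time `s`
  have hend : ∀ γ' : ℝ → X, IsLine γ' → (∀ n : ℕ, ∃ t, γ' n = γ t) → ∃ η : ℝ → X, IsRay η w ∧
      Tendsto (fun n : ℕ => gromovProd w (η n) (γ' n)) atTop atTop ∧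
      ∃ t, 0 ≤ t ∧ s ≤ gromovProd w (σ t) (η t) := by
    intro γ' hγ' hsub
    obtain ⟨η, hη, hηγ⟩ := H.exists_isRay hgeo w hγ'.isGromovSeq
    obtain ⟨n, h1, h2⟩ := ((tendsto_atTop.1 hηγ (s + h)).and (eventually_ge_atTop m₀)).exists
    refine ⟨η, hη, hηγ, n, Nat.cast_nonneg n, ?_⟩
    obtain ⟨t, ht⟩ := hsub n
    have h3 := hγσ t n (hm₀.trans (by exact_mod_cast h2))
    rw [← ht] at h3
    have h4 := H.le h1 h3
    rw [gromovProd_comm]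
    linarith
  obtain ⟨η₁, hη₁, hηγ₁, hlow₁⟩ := hend γ hγ fun n => ⟨_, rfl⟩
  obtain ⟨η₂, hη₂, hηγ₂, hlow₂⟩ := hend _ hγ.reverse fun n => ⟨_, rfl⟩
  set B := s + (a + |r₁| + 3 * h) with hB
  by_cases hup : ∀ t, 0 ≤ t → gromovProd w (σ t) (η₁ t) ≤ B
  · exact ⟨η₁, hη₁, hup, hlow₁⟩
  refine ⟨η₂, hη₂, fun t ht => ?_, hlow₂⟩
  -- otherwise both ends of `γ` would follow `σ`, hence each other, for too long
  by_contra! hcon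
  push Not at hup
  obtain ⟨t₁, ht₁, hcon₁⟩ := hup
  obtain ⟨m, hm⟩ := exists_nat_ge (max (max t t₁) |t₀|)
  obtain ⟨n, h1, h2, h3⟩ := ((tendsto_atTop.1 hηγ₁ (B + 1)).and
    ((tendsto_atTop.1 hηγ₂ (B + 1)).and (eventually_ge_atTop m))).exists
  have hn : max (max t t₁) |t₀| ≤ (n : ℝ) := hm.trans (by exact_mod_cast h3)
  have hnt : t ≤ n := ((le_max_left _ _).trans (le_max_left _ _)).trans hn
  have hnt₁ : t₁ ≤ n := ((le_max_right _ _).trans (le_max_left _ _)).trans hn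
  have hnt₀ := abs_le.1 ((le_max_right _ _).trans hn)
  have h4 := hcon.trans_le (hσ.gromovProd_mono hη₂ ht ht hnt hnt)
  have h5 := hcon₁.trans_le (hσ.gromovProd_mono hη₁ ht₁ ht₁ hnt₁ hnt₁)
  have h6 : gromovProd w (γ n) (γ (-(n : ℝ))) ≤ s + a + r₁ := by
    have h7 : dist (γ n) (γ t₀) + dist (γ t₀) (γ (-(n : ℝ))) = dist (γ n) (γ (-(n : ℝ))) := by
      rw [hγ.dist_eq, hγ.dist_eq, hγ.dist_eq, Real.dist_eq, Real.dist_eq, Real.dist_eq,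
        abs_of_nonneg (by linarith), abs_of_nonneg (by linarith), abs_of_nonneg (by linarith)]
      ring
    have h8 := gromovProd_le_dist_of_between (w := w) h7
    have h9 := dist_triangle_left (γ t₀) w (σ (s + a))
    rw [hσ.dist_eq hs'] at h9
    linarith
  rw [gromovProd_comm] at h5 h1
  have h7 := H.lt (show B - h < gromovProd w (γ n) (η₁ n) by linarith) (H.lt h5 h4)
  have h8 := H.lt h7 (show B - h - h < gromovProd w (η₂ n) (γ (-(n : ℝ))) by linarith)
  linarith

/-! ### Stretching long unbranched tubes -/

theorem dist_map_le_of_coarse {Y : Type*} [MetricSpace Y]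
    (hgeo : IsGeodesicSpace X) {f : X → Y} {c : ℝ} (hc : 0 ≤ c)
    (hf : ∀ x y, dist x y ≤ 1 → dist (f x) (f y) ≤ c) (x y : X) :
    dist (f x) (f y) ≤ c * dist x y + c := by
  have key : ∀ (n : ℕ) (y : X), dist x y ≤ n → dist (f x) (f y) ≤ c * n := by
    intro n
    induction n with
    | zero =>
      intro y hy
      rw [Nat.cast_zero] at hy
      simp [dist_le_zero.1 hy]
    | succ n ih =>
      intro y hy
      push_cast at hy ⊢
      obtain ⟨g, hg⟩ := hgeo.exists_isGeodesic x y
      have ht : min (n : ℝ) (dist x y) ∈ Set.Icc 0 (dist x y) :=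
        ⟨le_min (Nat.cast_nonneg n) dist_nonneg, min_le_right _ _⟩
      have h1 := ih (g (min n (dist x y))) (by rw [hg.dist_left ht]; exact min_le_left _ _)
      have h2 := hf (g (min n (dist x y))) y (by
        rw [hg.dist_right ht]
        rcases le_total (n : ℝ) (dist x y) with h | h
        · rw [min_eq_left h]; linarith
        · rw [min_eq_right h]; linarith)
      have h3 := dist_triangle (f x) (f (g (min n (dist x y)))) (f y)
      linarith
  have h1 := key ⌈dist x y⌉₊ y (Nat.le_ceil _)
  have h2 := mul_le_mul_of_nonneg_left (Nat.ceil_lt_add_one (dist_nonneg (x := x) (y := y))).le hc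
  linarith

theorem isQuasiIsometry_of_inverse (hgeo : IsGeodesicSpace X) {f g : X → X} {c e : ℝ} (hc : 1 ≤ c)
    (he : 0 ≤ e) (hf : ∀ x y, dist x y ≤ 1 → dist (f x) (f y) ≤ c)
    (hg : ∀ x y, dist x y ≤ 1 → dist (g x) (g y) ≤ c) (hgf : ∀ x, dist (g (f x)) x ≤ e)
    (hfg : ∀ x, dist (f (g x)) x ≤ e) : IsQuasiIsometry f := by
  have hc0 : 0 < c := by linarith
  refine ⟨c, 2 * e + c, hc, by positivity, fun x y => ⟨?_, ?_⟩, fun y => ⟨g y, ?_⟩⟩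
  · have h1 := dist_map_le_of_coarse hgeo hc0.le hg (f x) (f y)
    have h2 := dist_triangle4 x (g (f x)) (g (f y)) y
    have h3 := hgf x
    rw [dist_comm] at h3
    have h4 := hgf y
    have h5 : 2 * e + c ≤ c * (2 * e + c) := le_mul_of_one_le_left (by positivity) hc
    rw [sub_le_iff_le_add, inv_mul_le_iff₀ hc0]
    linarith
  · have := dist_map_le_of_coarse hgeo hc0.le hf x y
    linarith
  · rw [dist_comm]
    linarith [hfg y]

/-- A family of segments `σ n '' [s n, s n + m n]` of rays from `w`, of unbounded length, such that
no ray branches off from `σ n` along the `n`-th segment. The `A`-neighbourhoods of the segments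
(the tubes) lie in disjoint shells around `w`. -/
structure TubeFamily (w : X) (A : ℝ) where
  /-- the rays along which the tubes lie -/
  σ : ℕ → ℝ → X
  /-- the distances from `w` at which the tubes begin -/
  s : ℕ → ℝ
  /-- the lengths of the tubes -/
  m : ℕ → ℝ
  isRay : ∀ n, IsRay (σ n) w
  s_nonneg : ∀ n, 0 ≤ s n
  le_m : ∀ n : ℕ, (n : ℝ) ≤ m n
  gap : ∀ n η, IsRay η w → (∃ t, 0 ≤ t ∧ s n + m n < gromovProd w (σ n t) (η t)) ∨
    ∀ t, 0 ≤ t → gromovProd w (σ n t) (η t) < s n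
  disjoint : ∀ n k, n < k → s n + m n + 2 * A < s k

theorem nonempty_tubeFamily {w : X} (hN : ¬ ∃ N, 0 ≤ N ∧ RaysBranch w N) {A : ℝ} (hA : 0 ≤ A) :
    Nonempty (TubeFamily w A) := by
  have hgap : ∀ M : ℝ, ∃ (σ : ℝ → X) (s : ℝ), 0 ≤ s ∧ M ≤ s ∧ IsRay σ w ∧ ∀ η, IsRay η w →
      (∃ t, 0 ≤ t ∧ s + M < gromovProd w (σ t) (η t)) ∨
        ∀ t, 0 ≤ t → gromovProd w (σ t) (η t) < s := by
    intro M
    have h1 : ¬ RaysBranch w (2 * |M|) := fun h => hN ⟨_, by positivity, h⟩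
    simp only [RaysBranch] at h1
    push Not at h1
    obtain ⟨σ, hσ, s, hs, hη⟩ := h1
    have hM := le_abs_self M
    have hM0 := abs_nonneg M
    refine ⟨σ, s + |M|, by positivity, by linarith, hσ, fun η hηr => ?_⟩
    by_cases hup : ∀ t, 0 ≤ t → gromovProd w (σ t) (η t) ≤ s + 2 * |M|
    · exact Or.inr fun t ht => (hη η hηr hup t ht).trans_le (by linarith)
    · push Not at hup
      obtain ⟨t, ht, h2⟩ := hup
      exact Or.inl ⟨t, ht, by linarith⟩
  choose σ s hs0 hMs hσ hη using hgap
  set M : ℕ → ℝ := fun n => Nat.rec 0 (fun _ r => s r + r + 2 * A + 1) n with hM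
  have hMsucc : ∀ n, M (n + 1) = s (M n) + M n + 2 * A + 1 := fun n => rfl
  have hMn : ∀ n : ℕ, (n : ℝ) ≤ M n := by
    intro n
    induction n with
    | zero => simp [hM]
    | succ n ih =>
      rw [hMsucc]
      push_cast
      linarith [hs0 (M n)]
  have hmono : Monotone M := monotone_nat_of_le_succ fun n => by
    rw [hMsucc]
    linarith [hs0 (M n)]
  refine ⟨⟨fun n => σ (M n), fun n => s (M n), M, fun n => hσ _, fun n => hs0 _, hMn,
    fun n => hη _, fun n k hnk => ?_⟩⟩
  have h1 := hmono (Nat.succ_le_of_lt hnk)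
  rw [hMsucc] at h1
  linarith [hMs (M k)]

namespace TubeFamily

variable {w : X} {A : ℝ} (T : TubeFamily w A)

/-- The point `x` lies in the `n`-th tube, at time `τ`. -/
def InTube (n : ℕ) (τ : ℝ) (x : X) : Prop :=
  T.s n ≤ τ ∧ τ ≤ T.s n + T.m n ∧ dist x (T.σ n τ) ≤ A

open Classical in
/-- The map that moves the point of the `n`-th tube at time `τ` to the point of the ray `σ n` at
time `φ n τ`, and fixes all points outside the tubes. -/
noncomputable def stretch (φ : ℕ → ℝ → ℝ) (x : X) : X :=
  if h : ∃ p : ℕ × ℝ, T.InTube p.1 p.2 x then T.σ h.choose.1 (φ h.choose.1 h.choose.2) else x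

theorem stretch_spec (φ : ℕ → ℝ → ℝ) (x : X) :
    (∃ n τ, T.InTube n τ x ∧ T.stretch φ x = T.σ n (φ n τ)) ∨
      ((∀ n τ, ¬ T.InTube n τ x) ∧ T.stretch φ x = x) := by
  by_cases h : ∃ p : ℕ × ℝ, T.InTube p.1 p.2 x
  · exact Or.inl ⟨_, _, h.choose_spec, by rw [stretch, dif_pos h]⟩
  · exact Or.inr ⟨fun n τ hn => h ⟨(n, τ), hn⟩, by rw [stretch, dif_neg h]⟩

variable {T}

theorem dist_σ {n : ℕ} {τ τ' : ℝ} (h : T.s n ≤ τ) (h' : T.s n ≤ τ') :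
    dist (T.σ n τ) (T.σ n τ') = |τ - τ'| :=
  (T.isRay n).2 _ ((T.s_nonneg n).trans h) _ ((T.s_nonneg n).trans h')

theorem InTube.eq {n k : ℕ} {τ τ' : ℝ} {x : X} (hn : T.InTube n τ x) (hk : T.InTube k τ' x) :
    n = k := by
  have h1 := (T.isRay n).dist_eq ((T.s_nonneg n).trans hn.1)
  have h2 := (T.isRay k).dist_eq ((T.s_nonneg k).trans hk.1)
  have h3 := dist_triangle x (T.σ n τ) w
  have h4 := dist_triangle_left (T.σ n τ) w x
  have h5 := dist_triangle x (T.σ k τ') w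
  have h6 := dist_triangle_left (T.σ k τ') w x
  obtain ⟨a1, a2, a3⟩ := hn
  obtain ⟨b1, b2, b3⟩ := hk
  rcases lt_trichotomy n k with h | h | h
  · linarith [T.disjoint n k h]
  · exact h
  · linarith [T.disjoint k n h]

/-- Away from the two ends, one cannot leave a tube by a step of length `1`: a nearby point is
close to a ray that follows `σ n` beyond time `s n`, and therefore up to time `s n + m n`. -/
theorem InTube.exists_of_dist_le {h L : ℝ} (H : FourPoint h X) (hh : 0 ≤ h)
    (hpole : IsRayPole L w) (hL : 0 ≤ L) {T : TubeFamily w (L + 4 * h)} {n : ℕ} {τ : ℝ} {x y : X}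
    (hx : T.InTube n τ x) (hxy : dist x y ≤ 1) (h1 : T.s n + (2 * L + 4 * h + 1) ≤ τ)
    (h2 : τ ≤ T.s n + T.m n - (2 * L + 4 * h + 1)) : ∃ ρ, T.InTube n ρ y := by
  obtain ⟨η, hη, hyη⟩ := hpole y
  set ρ := dist y w with hρ
  have hσ := T.isRay n
  have hs := T.s_nonneg n
  have hρ0 : 0 ≤ ρ := dist_nonneg
  have hτ0 : 0 ≤ τ := hs.trans hx.1
  have hyσ : dist y (T.σ n τ) ≤ L + 4 * h + 1 := by
    have := dist_triangle_left y (T.σ n τ) x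
    linarith [hx.2.2]
  have hρτ : |ρ - τ| ≤ L + 4 * h + 1 := by
    have := abs_dist_sub_le y (T.σ n τ) w
    rw [hσ.dist_eq hτ0] at this
    exact this.trans hyσ
  obtain ⟨h3, h4⟩ := abs_le.1 hρτ
  refine ⟨ρ, by linarith, by linarith, ?_⟩
  have h5 : T.s n ≤ gromovProd w (T.σ n τ) (η ρ) := by
    have h6 := gromovProd_le_gromovProd_add_dist_right w (T.σ n τ) (T.σ n τ) (η ρ)
    rw [gromovProd_self, hσ.dist_eq hτ0] at h6
    have h7 := dist_triangle_left (T.σ n τ) (η ρ) y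
    linarith
  rcases T.gap n η hη with ⟨t, ht, h6⟩ | h6
  · -- the two rays follow each other beyond time `ρ`
    set t' := max t (T.s n + T.m n) with ht'
    have htt : t ≤ t' := le_max_left _ _
    have ht0 : 0 ≤ t' := ht.trans htt
    have hρt : ρ ≤ t' := le_trans (by linarith) (le_max_right _ _)
    have h7 := h6.trans_le (hσ.gromovProd_mono hη ht ht htt htt)
    have h8 := hσ.gromovProd_eq hρ0 ht0
    have h9 := hη.gromovProd_eq ht0 hρ0
    rw [min_eq_left hρt] at h8
    rw [min_eq_right hρt] at h9
    have h10 := H.le (H.le h8.ge (show ρ ≤ gromovProd w (T.σ n t') (η t') by linarith))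
      (show ρ - h ≤ gromovProd w (η t') (η ρ) by linarith)
    rw [gromovProd, hσ.dist_eq hρ0, hη.dist_eq hρ0] at h10
    have h11 := dist_triangle_right y (T.σ n ρ) (η ρ)
    linarith
  · have h7 := hσ.gromovProd_mono hη hτ0 hρ0 (le_max_left τ ρ) (le_max_right τ ρ)
    have h8 := h6 (max τ ρ) (hτ0.trans (le_max_left _ _))
    linarith

variable (T) in
/-- The maps `φ n` restrict to `2`-Lipschitz maps of the time intervals of the tubes that fix the
end points. -/
structure IsReparam (φ : ℕ → ℝ → ℝ) : Prop where
  left : ∀ n, φ n (T.s n) = T.s n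
  right : ∀ n, φ n (T.s n + T.m n) = T.s n + T.m n
  lip : ∀ n a b, |φ n a - φ n b| ≤ 2 * |a - b|
  mem : ∀ n a, T.s n ≤ a → a ≤ T.s n + T.m n → T.s n ≤ φ n a ∧ φ n a ≤ T.s n + T.m n

theorem dist_stretch_le {h L : ℝ} (H : FourPoint h X) (hh : 0 ≤ h) (hpole : IsRayPole L w)
    (hL : 0 ≤ L) {T : TubeFamily w (L + 4 * h)} {φ : ℕ → ℝ → ℝ} (hφ : T.IsReparam φ) {x y : X}
    (hxy : dist x y ≤ 1) : dist (T.stretch φ x) (T.stretch φ y) ≤ 14 * L + 32 * h + 7 := by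
  -- a point from which one leaves its tube by a short step is moved by a bounded amount
  have hend : ∀ x y n τ, dist x y ≤ 1 → T.InTube n τ x → (∀ ρ, ¬ T.InTube n ρ y) →
      dist (T.σ n (φ n τ)) x ≤ 7 * L + 16 * h + 3 := by
    intro x y n τ hxy hx hy
    have h1 := dist_σ (hφ.mem n τ hx.1 hx.2.1).1 hx.1
    have h2 := dist_triangle_right (T.σ n (φ n τ)) x (T.σ n τ)
    have h3 := hx.2.2
    suffices h4 : |φ n τ - τ| ≤ 3 * (2 * L + 4 * h + 1) by linarith
    have h5 : τ < T.s n + (2 * L + 4 * h + 1) ∨ T.s n + T.m n - (2 * L + 4 * h + 1) < τ := by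
      by_contra! hcon
      obtain ⟨ρ, hρ⟩ := hx.exists_of_dist_le H hh hpole hL hxy hcon.1 hcon.2
      exact hy ρ hρ
    rcases h5 with h5 | h5
    · have h6 := hφ.lip n τ (T.s n)
      rw [hφ.left, abs_of_nonneg (by linarith [hx.1] : (0 : ℝ) ≤ τ - T.s n)] at h6
      obtain ⟨h7, h8⟩ := abs_le.1 h6
      exact abs_le.2 ⟨by linarith [hx.1], by linarith [hx.1]⟩
    · have h6 := hφ.lip n τ (T.s n + T.m n)
      rw [hφ.right, abs_of_nonpos (by linarith [hx.2.1] : τ - (T.s n + T.m n) ≤ 0)] at h6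
      obtain ⟨h7, h8⟩ := abs_le.1 h6
      exact abs_le.2 ⟨by linarith [hx.2.1], by linarith [hx.2.1]⟩
  have hmoved : ∀ x y, dist x y ≤ 1 → (∀ n τ ρ, T.InTube n τ x → ¬ T.InTube n ρ y) →
      dist (T.stretch φ x) x ≤ 7 * L + 16 * h + 3 := by
    intro x y hxy hnot
    rcases T.stretch_spec φ x with ⟨n, τ, hx, hx'⟩ | ⟨-, hx'⟩
    · rw [hx']
      exact hend x y n τ hxy hx fun ρ => hnot n τ ρ hx
    · rw [hx', dist_self]
      positivity
  by_cases hcommon : ∃ n τ ρ, T.InTube n τ x ∧ T.InTube n ρ y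
  · obtain ⟨n, τ, ρ, hx, hy⟩ := hcommon
    rcases T.stretch_spec φ x with ⟨n', τ', hx', ex⟩ | ⟨hx', -⟩
    swap
    · exact absurd hx (hx' n τ)
    rcases T.stretch_spec φ y with ⟨k', ρ', hy', ey⟩ | ⟨hy', -⟩
    swap
    · exact absurd hy (hy' n ρ)
    obtain rfl := hx.eq hx'
    obtain rfl := hy.eq hy'
    rw [ex, ey, dist_σ (hφ.mem _ _ hx'.1 hx'.2.1).1 (hφ.mem _ _ hy'.1 hy'.2.1).1]
    refine (hφ.lip _ _ _).trans ?_
    rw [← dist_σ hx'.1 hy'.1]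
    have h1 := dist_triangle4 (T.σ n τ') x y (T.σ n ρ')
    rw [dist_comm (T.σ n τ') x] at h1
    linarith [hx'.2.2, hy'.2.2]
  · push Not at hcommon
    have h1 := hmoved x y hxy hcommon
    have h2 := hmoved y x (by rwa [dist_comm]) fun n τ ρ hy hx => hcommon n ρ τ hx hy
    have h3 := dist_triangle4 (T.stretch φ x) x y (T.stretch φ y)
    rw [dist_comm y] at h3
    linarith

theorem dist_stretch_stretch_le (hA : 0 ≤ A) {φ ψ : ℕ → ℝ → ℝ} (hφ : T.IsReparam φ)
    (hψ : T.IsReparam ψ) (hψφ : ∀ n τ, ψ n (φ n τ) = τ) (x : X) :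
    dist (T.stretch ψ (T.stretch φ x)) x ≤ 3 * A := by
  rcases T.stretch_spec φ x with ⟨n, τ, hx, ex⟩ | ⟨hx, ex⟩
  · obtain ⟨h1, h2⟩ := hφ.mem n τ hx.1 hx.2.1
    have hin : T.InTube n (φ n τ) (T.stretch φ x) := ⟨h1, h2, by rwa [ex, dist_self]⟩
    rcases T.stretch_spec ψ (T.stretch φ x) with ⟨k, ρ, hy, ey⟩ | ⟨hy, -⟩
    · obtain rfl := hin.eq hy
      have h3 := hy.2.2
      rw [ex, dist_σ h1 hy.1, abs_sub_comm] at h3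
      have h4 := hψ.lip n ρ (φ n τ)
      rw [hψφ, ← dist_σ (hψ.mem _ _ hy.1 hy.2.1).1 hx.1] at h4
      have h5 := dist_triangle_right (T.σ n (ψ n ρ)) x (T.σ n τ)
      rw [ey]
      linarith [hx.2.2]
    · exact absurd hin (hy _ _)
  · rcases T.stretch_spec ψ x with ⟨k, ρ, hy, -⟩ | ⟨-, ey⟩
    · exact absurd hy (hx k ρ)
    · rw [ex, ey, dist_self]
      positivity

/-- A piecewise linear homeomorphism of the time intervals of the tubes which moves the point
`2 / 3` of the way to the point `1 / 3` of the way. -/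
noncomputable def push (T : TubeFamily w A) (n : ℕ) (τ : ℝ) : ℝ :=
  T.s n + max ((τ - T.s n) / 2) (2 * (τ - T.s n) - T.m n)

/-- The inverse of `push`. -/
noncomputable def pull (T : TubeFamily w A) (n : ℕ) (τ : ℝ) : ℝ :=
  T.s n + min (2 * (τ - T.s n)) ((τ - T.s n + T.m n) / 2)

theorem m_nonneg (n : ℕ) : 0 ≤ T.m n := (Nat.cast_nonneg n).trans (T.le_m n)

theorem isReparam_push : T.IsReparam T.push where
  left n := by simp [push, m_nonneg]
  right n := by
    have := T.m_nonneg n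
    rw [push, max_eq_right (by linarith)]
    ring
  lip n a b := by
    have h1 := abs_max_sub_max_le_max ((a - T.s n) / 2) (2 * (a - T.s n) - T.m n)
      ((b - T.s n) / 2) (2 * (b - T.s n) - T.m n)
    rw [push, push, add_sub_add_left_eq_sub]
    refine h1.trans (max_le ?_ ?_)
    · rw [show (a - T.s n) / 2 - (b - T.s n) / 2 = (a - b) / 2 by ring, abs_div, abs_two]
      linarith [abs_nonneg (a - b)]
    · rw [show 2 * (a - T.s n) - T.m n - (2 * (b - T.s n) - T.m n) = 2 * (a - b) by ring, abs_mul,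
        abs_two]
  mem n a h1 h2 := by
    have := le_max_left ((a - T.s n) / 2) (2 * (a - T.s n) - T.m n)
    have h3 : max ((a - T.s n) / 2) (2 * (a - T.s n) - T.m n) ≤ T.m n :=
      max_le (by linarith) (by linarith)
    exact ⟨by rw [push]; linarith, by rw [push]; linarith⟩

theorem isReparam_pull : T.IsReparam T.pull where
  left n := by
    have := T.m_nonneg n
    rw [pull, min_eq_left (by linarith)]
    ring
  right n := by
    have := T.m_nonneg n
    rw [pull, min_eq_right (by linarith)]
    ring
  lip n a b := by
    have h1 := abs_min_sub_min_le_max (2 * (a - T.s n)) ((a - T.s n + T.m n) / 2)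
      (2 * (b - T.s n)) ((b - T.s n + T.m n) / 2)
    rw [pull, pull, add_sub_add_left_eq_sub]
    refine h1.trans (max_le ?_ ?_)
    · rw [← mul_sub, sub_sub_sub_cancel_right, abs_mul, abs_two]
    · rw [show (a - T.s n + T.m n) / 2 - (b - T.s n + T.m n) / 2 = (a - b) / 2 by ring, abs_div,
        abs_two]
      linarith [abs_nonneg (a - b)]
  mem n a h1 h2 := by
    have := min_le_right (2 * (a - T.s n)) ((a - T.s n + T.m n) / 2)
    have h3 : 0 ≤ min (2 * (a - T.s n)) ((a - T.s n + T.m n) / 2) :=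
      le_min (by linarith) (by linarith)
    exact ⟨by rw [pull]; linarith, by rw [pull]; linarith⟩

theorem pull_push (n : ℕ) (τ : ℝ) : T.pull n (T.push n τ) = τ := by
  have := T.m_nonneg n
  rw [pull, push]
  rcases le_total ((τ - T.s n) / 2) (2 * (τ - T.s n) - T.m n) with h | h
  · rw [max_eq_right h, min_eq_right (by linarith)]; ring
  · rw [max_eq_left h, min_eq_left (by linarith)]; ring

theorem push_pull (n : ℕ) (τ : ℝ) : T.push n (T.pull n τ) = τ := by
  have := T.m_nonneg n
  rw [pull, push]
  rcases le_total (2 * (τ - T.s n)) ((τ - T.s n + T.m n) / 2) with h | h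
  · rw [min_eq_left h, max_eq_left (by linarith)]; ring
  · rw [min_eq_right h, max_eq_right (by linarith)]; ring

/-- Points in the tubes are moved along rays from `w`, and their distance from `w` is at most
halved, so the Gromov product of a point and its image goes to infinity with the point. -/
theorem isBoundaryMap_stretch {h : ℝ} (H : FourPoint h X) (hA : 0 ≤ A) :
    IsBoundaryMap (T.stretch T.push) (id : Boundary X → Boundary X) := by
  have key : ∀ x, dist x w / 2 - 2 * A ≤ gromovProd w x (T.stretch T.push x) := by
    intro x
    have hx0 : 0 ≤ dist x w := dist_nonneg
    rcases T.stretch_spec T.push x with ⟨n, τ, hx, ex⟩ | ⟨-, ex⟩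
    · have hτ0 := (T.s_nonneg n).trans hx.1
      obtain ⟨h1, -⟩ := isReparam_push.mem n τ hx.1 hx.2.1
      have h2 : τ / 2 ≤ T.push n τ := by
        have := le_max_left ((τ - T.s n) / 2) (2 * (τ - T.s n) - T.m n)
        rw [push]
        linarith [T.s_nonneg n]
      have h3 := (T.isRay n).gromovProd_eq hτ0 ((T.s_nonneg n).trans h1)
      have h4 := le_min (show τ / 2 ≤ τ by linarith) h2
      have h5 := gromovProd_le_gromovProd_add_dist_left w (T.σ n τ) x (T.σ n (T.push n τ))
      have h6 := dist_triangle x (T.σ n τ) w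
      rw [(T.isRay n).dist_eq hτ0] at h6
      rw [dist_comm] at h5
      rw [ex]
      linarith [hx.2.2]
    · rw [ex, gromovProd_self]
      linarith
  intro u ξ hu
  refine H.represents_of_tendsto (w := w) hu (tendsto_atTop_mono (fun i => key (u i)) ?_)
  exact tendsto_atTop_add_const_right _ (-(2 * A)) ((hu.1.tendsto_dist w).atTop_div_const two_pos)

theorem not_bddAbove_stretch (hA : 0 ≤ A) :
    ¬ BddAbove (Set.range fun x : X => dist x (T.stretch T.push x)) := by
  rintro ⟨b, hb⟩
  obtain ⟨n, hn⟩ := exists_nat_gt (3 * (b + 2 * A))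
  have hm := T.le_m n
  have hm0 := T.m_nonneg n
  set τ := T.s n + 2 * T.m n / 3 with hτ
  have h1 : T.s n ≤ τ := by rw [hτ]; linarith
  have hin : T.InTube n τ (T.σ n τ) := ⟨h1, by rw [hτ]; linarith, by rwa [dist_self]⟩
  rcases T.stretch_spec T.push (T.σ n τ) with ⟨k, ρ, hx, ex⟩ | ⟨hx, -⟩
  · obtain rfl := hin.eq hx
    have h2 := hx.2.2
    rw [dist_σ h1 hx.1, abs_sub_comm] at h2
    have h3 := (isReparam_push (T := T)).lip n ρ τ
    have h4 : T.push n τ = T.s n + T.m n / 3 := by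
      rw [push, hτ, max_eq_left (by linarith)]; ring
    have h5 := hb ⟨T.σ n τ, rfl⟩
    simp only [ex] at h5
    rw [dist_σ h1 (isReparam_push.mem _ _ hx.1 hx.2.1).1] at h5
    have h6 := (abs_le.1 h3).2
    have h7 := (le_abs_self _).trans h5
    linarith
  · exact hx _ _ hin

end TubeFamily

/-- Contrapositively: if rays do not branch uniformly, there are ever longer tubes without
branching, and sliding along these tubes is a quasi-isometry of infinite displacement. -/
theorem IsBoundaryRigid.exists_raysBranch {h L : ℝ} (H : FourPoint h X) (hh : 0 ≤ h)
    (hgeo : IsGeodesicSpace X) {w : X} (hL : 0 ≤ L) (hpole : IsRayPole L w)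
    (hrigid : IsBoundaryRigid X) : ∃ N, 0 ≤ N ∧ RaysBranch w N := by
  by_contra hN
  have hA : 0 ≤ L + 4 * h := by positivity
  obtain ⟨T⟩ := nonempty_tubeFamily hN hA
  refine T.not_bddAbove_stretch hA (hrigid _ ?_ (T.isBoundaryMap_stretch H hA))
  exact isQuasiIsometry_of_inverse hgeo (c := 14 * L + 32 * h + 7) (e := 3 * (L + 4 * h))
    (by linarith) (by positivity)
    (fun _ _ => TubeFamily.dist_stretch_le H hh hpole hL TubeFamily.isReparam_push)
    (fun _ _ => TubeFamily.dist_stretch_le H hh hpole hL TubeFamily.isReparam_pull)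
    (TubeFamily.dist_stretch_stretch_le hA TubeFamily.isReparam_push TubeFamily.isReparam_pull
      TubeFamily.pull_push)
    (TubeFamily.dist_stretch_stretch_le hA TubeFamily.isReparam_pull TubeFamily.isReparam_push
      TubeFamily.push_pull)

end Hyp

theorem theorem1p3 {X : Type*} [MetricSpace X] [ProperSpace X]
    (hgeo : Hyp.IsGeodesicSpace X) (δ : ℝ) (hδ : 0 < δ) (hhyp : Hyp.IsHyperbolic δ X)
    (hpole : Hyp.HasPole X)
    (w : X) (ε : ℝ) (hε : 0 < ε) (hε' : ε < min 1 (1 / (5 * δ))) :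
    [Hyp.IsBoundaryRigid X,
      Hyp.IsUniformlyPerfect (Hyp.visualDist (X := X) w ε),
      Hyp.IsGeodesicallyRich X].TFAE := by
  have H := hhyp.fourPoint hδ.le hgeo
  have hh : 0 ≤ 3 * δ := by positivity
  obtain ⟨L, hL, hray⟩ := hpole.exists_isRayPole H hh hgeo w
  -- `exp (3 / 5) < 2`, so that Frink's lemma applies
  have hεh : ε * (3 * δ) ≤ Real.log 2 := by
    have h1 := hε'.trans_le (min_le_right _ _)
    rw [lt_div_iff₀ (by positivity)] at h1
    have h2 := Real.log_two_gt_d9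
    linarith
  tfae_have 1 → 2 := fun h1 => by
    obtain ⟨N, hN0, hN⟩ := h1.exists_raysBranch H hh hgeo hL hray
    exact H.isUniformlyPerfect hh hgeo hε hεh hN0 hN
  tfae_have 2 → 1 := fun h2 => by
    obtain ⟨N, hN0, hN⟩ := H.exists_raysBranch hh hgeo hε hεh h2
    exact (H.hasTripods hh hL hray hN0 hN).isBoundaryRigid hδ.le hhyp H hh hgeo
  tfae_have 2 → 3 := fun h2 => by
    obtain ⟨N, hN0, hN⟩ := H.exists_raysBranch hh hgeo hε hεh h2
    exact (H.hasTripods hh hL hray hN0 hN).isGeodesicallyRich hδ.le hhyp H hh hgeo (by positivity)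
  tfae_have 3 → 2 := fun h3 => by
    obtain ⟨N, hN0, hN⟩ := h3.exists_raysBranch H hh hgeo w
    exact H.isUniformlyPerfect hh hgeo hε hεh hN0 hN
  tfae_finish
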